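/- For integers $n,j\ge 1$ let $C_n^j$ be the multigraph obtained from a path of length $n-1$ with endpoints $u$ and $v$ by adding $j$ parallel edges joining $u$ and $v$. For a finite multigraph $\Gamma=(V,E)$ let $$T(\Gamma;x,y)=\sum_{A\subseteq E}(x-1)^{r(E)-r(A)}(y-1)^{|A|-r(A)}\in\mathbf Z[x,y]$$ be its Tutte polynomial, where $r(A)=|V|-c(V,A)$ and $c(V,A)$ is the number of connected components of the spanning subgraph with edge set $A$. For a field $k$, let $G_{k,y}(T)$ denote the Galois group of a splitting field of $T(x,y)$, seen as a polynomial in $x$ over $k(y)$; it acts on the roots of $T$ in that splitting field. Let $k$ be a number field, let $n\ge 3$, and let $j\geq 1$ be odd. Then: 1. $T(C_n^j;x,y)$ has exactly $n-1$ distinct roots in its splitting field over $k(y)$, and $G_{k,y}(T(C_n^j;x,y))$, as a permutation group on these roots, is isomorphic to a transitive subgroup of the symmetric group $\mathfrak S_{n-1}$ that contains a transposition; 2. if $n$ is odd, then $G_{k,y}(T(C_n^j;x,y))\simeq\mathfrak S_{n-1}$; 3. if $n-1$ is prime, then $G_{k,y}(T(C_n^j;x,y))\simeq\mathfrak S_{n-1}$;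 moreover the Galois group over $\mathbf Q$ of (a splitting field of) $T(C_n^j;x,-1)\in\mathbf Q[x]$ is isomorphic to $\mathfrak S_{n-1}$. -/

import Mathlib

open Polynomial

noncomputable section

namespace Graph

variable {α β : Type*}

/-- The number of connected components of a multigraph, that is, of its underlying simple graph. -/
def numComponents (G : Graph α β) : ℕ :=
  Nat.card G.toSimpleGraph.ConnectedComponent

/-- The rank `r(A) = |V| - c(V, A)` of a set `A` of edges in the cycle matroid of a multigraph with
finitely many vertices, where `c(V, A)` is the number of connected components of the spanning
subgraph with edge set `A`. -/
def edgeRank (G : Graph α β) (A : Set β) : ℕ :=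
  G.vertexSet.ncard - (G.restrict A).numComponents

open Classical in
/-- The Tutte polynomial
`T(x, y) = ∑_{A ⊆ E} (x - 1) ^ (r(E) - r(A)) * (y - 1) ^ (|A| - r(A))`
of a finite multigraph, as a polynomial in `x` with coefficients in `ℤ[y]`: the outer variable
`X` is `x` and the inner variable `C X` is `y`. -/
def tuttePoly [Fintype β] (G : Graph α β) : ℤ[X][X] :=
  ∑ A ∈ Finset.univ.filter (fun A : Finset β => (A : Set β) ⊆ G.edgeSet),
    (X - 1) ^ (G.edgeRank G.edgeSet - G.edgeRank (A : Set β)) *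
      (C X - 1) ^ (A.card - G.edgeRank (A : Set β))

end Graph

/-- The cycle with a thick edge `C_n^j` (for `n ≥ 1`): a path `0, 1, …, n - 1` of length `n - 1`,
whose edges are the `Sum.inl i`, with `j` further parallel edges `Sum.inr l` joining its
endpoints `0` and `n - 1`. -/
def thickCycle (n j : ℕ) : Graph (Fin n) (Fin (n - 1) ⊕ Fin j) where
  vertexSet := Set.univ
  IsLink e u v := match e with
    | Sum.inl i => (u.val = i.val ∧ v.val = i.val + 1) ∨ (v.val = i.val ∧ u.val = i.val + 1)
    | Sum.inr _ => (u.val = 0 ∧ v.val = n - 1) ∨ (v.val = 0 ∧ u.val = n - 1)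
  isLink_symm := by
    rintro (i | l) - <;> exact ⟨fun u v h => h.symm⟩
  eq_or_eq_of_isLink_of_isLink := by
    rintro (i | l) x y v w h h' <;> simp only [Fin.ext_iff] at * <;> omega
  left_mem_of_isLink := by simp

/-- A polynomial in `ℤ[y][x]` viewed as a polynomial in `x` over the field `k(y)`. -/
def overRatFunc (k : Type*) [Field k] (T : ℤ[X][X]) : (RatFunc k)[X] :=
  T.map ((algebraMap k[X] (RatFunc k)).comp (mapRingHom (Int.castRingHom k)))

/-- The polynomial `T(x, a) ∈ ℚ[x]` obtained from `T(x, y) ∈ ℤ[y][x]` by setting `y = a`. -/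
def specializeY (a : ℤ) (T : ℤ[X][X]) : ℚ[X] :=
  T.map ((Int.castRingHom ℚ).comp (evalRingHom a))

end

/-! Put `m = n - 1`. Counting components gives `T = x^m + c(y) (x^(m-1) + ⋯ + x + y)` with `c = 1 +
y + ⋯ + y^(j-1)` (`tuttePoly_thickCycle`). For odd `j` this specializes at `y = -1` to `bonacci m`,
and `(x - 1) * bonacci m` is the trinomial `x^(m+1) - 2x + 1`. Where `2 ≠ 0`, this leaves at most
one multiple root, and that one is double. Hence inertia away from 2 acts on the roots of `bonacci
m` by the identity or a transposition.

Over `ℚ`, some odd prime `p` divides the discriminant of `bonacci m` to an odd power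
(`exists_prime_odd_valuation_derivRes_bonacci`): otherwise no odd prime ramifies, and the root field
has discriminant a power of 2 below Minkowski's bound. Odd valuation makes inertia at `p`
nontrivial, so it contains a transposition.

Over `K(y)` with `K` of characteristic zero, let `Δ(y)` be the discriminant of `T`. Since `Δ(-1)`
has odd valuation at `p`, some irreducible `h` divides `Δ` to an odd power with `p ∣ h(-1)`;
comparison with `y = 0` shows that `h` is not constant. At a zero of `h` at most one pair of roots
collides, because this already holds after reducing further to `y = -1` modulo `p`. So inertia above
`h` yields a transposition (`exists_isSwap_overRatFunc`). Irreducibility gives transitivity, and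
prime degree then forces the symmetric group.

For even `m` the collision bound also holds at 2. As `ℚ` has no unramified extension, inertia
generates the group of `bonacci m` over `ℚ`, which is therefore symmetric; specialization lifts this
to `ℚ(y)`. The group over `ℚ̄(y)` is normal in the one over `ℚ(y)` and contains a transposition, so
it is symmetric too, and so is the group over the intermediate field `k(y)`. -/

noncomputable section

/-! ### Components and ranks of edge sets in the thick cycle. -/

theorem SimpleGraph.card_connectedComponent_eq {V : Type*} (G : SimpleGraph V) {N : ℕ}
    (f : V → Fin N) (hf : Function.Surjective f) (h : ∀ u v, G.Reachable u v ↔ f u = f v) :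
    Nat.card G.ConnectedComponent = N := by
  have hb : Function.Bijective (Quot.lift f fun u v huv => (h u v).1 huv :
      G.ConnectedComponent → Fin N) := by
    refine ⟨?_, fun i => ?_⟩
    · rintro ⟨u⟩ ⟨v⟩ huv
      exact Quot.sound ((h u v).2 huv)
    · obtain ⟨v, rfl⟩ := hf i
      exact ⟨Quot.mk _ v, rfl⟩
  exact (Nat.card_congr (Equiv.ofBijective _ hb)).trans (Nat.card_fin N)

theorem SimpleGraph.map_eq_of_reachable {V α : Type*} {G : SimpleGraph V} {f : V → α}
    (h : ∀ u v, G.Adj u v → f u = f v) {u v : V} (huv : G.Reachable u v) : f u = f v := by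
  obtain ⟨p⟩ := huv
  induction p with
  | nil => rfl
  | cons hadj _ ih => exact (h _ _ hadj).trans ih

/-- The predicate on `i` that the `i`-th path edge of `C_n^j` belongs to `A`. -/
def pathMem {n j : ℕ} (A : Set (Fin (n - 1) ⊕ Fin j)) (i : ℕ) : Prop :=
  ∃ h : i < n - 1, Sum.inl ⟨i, h⟩ ∈ A

theorem thickCycle_edgeSet (n j : ℕ) (hn : 1 ≤ n) : (thickCycle n j).edgeSet = Set.univ := by
  ext e
  simp only [Set.mem_univ, iff_true]
  rw [Graph.edge_mem_iff_exists_isLink]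
  rcases e with i | l
  · exact ⟨⟨i, by omega⟩, ⟨i + 1, by omega⟩, Or.inl ⟨rfl, rfl⟩⟩
  · exact ⟨⟨0, by omega⟩, ⟨n - 1, by omega⟩, Or.inl ⟨rfl, rfl⟩⟩

theorem thickCycle_restrict_adj {n j : ℕ} (A : Set (Fin (n - 1) ⊕ Fin j))
    (u v : ((thickCycle n j).restrict A).vertexSet) :
    ((thickCycle n j).restrict A).toSimpleGraph.Adj u v ↔ u ≠ v ∧
      ((pathMem A u.1.val ∧ v.1.val = u.1.val + 1) ∨ (pathMem A v.1.val ∧ u.1.val = v.1.val + 1) ∨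
        ((∃ l, Sum.inr l ∈ A) ∧
          ((u.1.val = 0 ∧ v.1.val = n - 1) ∨ (v.1.val = 0 ∧ u.1.val = n - 1)))) := by
  rw [Graph.toSimpleGraph_adj]
  refine and_congr_right fun _ => ?_
  constructor
  · rintro ⟨e, he⟩
    rw [Graph.restrict_isLink] at he
    obtain ⟨heA, he⟩ := he
    rcases e with i | l
    · have hi := i.2
      rcases he with ⟨h1, h2⟩ | ⟨h1, h2⟩
      · exact Or.inl ⟨⟨by omega, by simpa [h1] using heA⟩, by omega⟩
      · exact Or.inr (Or.inl ⟨⟨by omega, by simpa [h1] using heA⟩, by omega⟩)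
    · exact Or.inr (Or.inr ⟨⟨l, heA⟩, he⟩)
  · rintro (⟨⟨h, hA⟩, h1⟩ | ⟨⟨h, hA⟩, h1⟩ | ⟨⟨l, hA⟩, h⟩)
    · exact ⟨_, (Graph.restrict_isLink _ _ _ _ _).mpr ⟨hA, Or.inl ⟨rfl, h1⟩⟩⟩
    · exact ⟨_, (Graph.restrict_isLink _ _ _ _ _).mpr ⟨hA, Or.inr ⟨rfl, h1⟩⟩⟩
    · exact ⟨_, (Graph.restrict_isLink _ _ _ _ _).mpr ⟨hA, h⟩⟩

open Classical in
/-- The number of the path edges of `C_n^j` before the vertex `v` that do not belong to `A`. -/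
def pathGaps {n j : ℕ} (A : Set (Fin (n - 1) ⊕ Fin j)) (v : ℕ) : ℕ :=
  Nat.count (fun i => ¬ pathMem A i) v

theorem pathGaps_zero {n j : ℕ} (A : Set (Fin (n - 1) ⊕ Fin j)) : pathGaps A 0 = 0 := by
  simp [pathGaps]

theorem pathGaps_mono {n j : ℕ} (A : Set (Fin (n - 1) ⊕ Fin j)) : Monotone (pathGaps A) := by
  classical exact Nat.count_monotone _

open Classical in
theorem pathGaps_succ {n j : ℕ} (A : Set (Fin (n - 1) ⊕ Fin j)) (v : ℕ) :
    pathGaps A (v + 1) = pathGaps A v + if pathMem A v then 0 else 1 := by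
  rw [pathGaps, Nat.count_succ, pathGaps]
  by_cases h : pathMem A v <;> simp [h]

open Classical in
theorem pathGaps_add_card {n j : ℕ} (A : Finset (Fin (n - 1) ⊕ Fin j)) :
    pathGaps (A : Set (Fin (n - 1) ⊕ Fin j)) (n - 1) + A.toLeft.card = n - 1 := by
  have h1 : ∀ N, pathGaps (A : Set (Fin (n - 1) ⊕ Fin j)) N +
      Nat.count (pathMem (A : Set (Fin (n - 1) ⊕ Fin j))) N = N := by
    intro N
    induction N with
    | zero => simp [pathGaps_zero]
    | succ N ih =>
      rw [pathGaps_succ, Nat.count_succ]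
      split_ifs <;> omega
  have h2 : A.toLeft.card = Nat.count (pathMem (A : Set (Fin (n - 1) ⊕ Fin j))) (n - 1) := by
    rw [Nat.count_eq_card_filter_range, ← Finset.card_map Fin.valEmbedding]
    congr 1
    ext i
    simp only [Finset.mem_map, Finset.mem_toLeft, Fin.valEmbedding_apply, Finset.mem_filter,
      Finset.mem_range, pathMem, Finset.mem_coe]
    exact ⟨by rintro ⟨a, ha, rfl⟩; exact ⟨a.2, a.2, ha⟩, fun ⟨_, h, ha⟩ => ⟨⟨i, h⟩, ha, rfl⟩⟩
  rw [h2, h1]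

/-- Equal gap counts mean that no path edge between the two vertices is missing, so one can walk
along the path. -/
theorem reachable_of_pathGaps_eq {n j : ℕ} (A : Set (Fin (n - 1) ⊕ Fin j))
    (u v : ((thickCycle n j).restrict A).vertexSet) (h : pathGaps A u.1.val = pathGaps A v.1.val) :
    ((thickCycle n j).restrict A).toSimpleGraph.Reachable u v := by
  wlog huv : u.1.val ≤ v.1.val generalizing u v
  · exact (this v u h.symm (by omega)).symm
  obtain ⟨⟨u, hu⟩, hu'⟩ := u
  obtain ⟨⟨v, hv⟩, hv'⟩ := v
  simp only at h huv
  induction v, huv using Nat.le_induction with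
  | base => exact SimpleGraph.Reachable.refl _
  | succ w hw ih =>
    have hm1 := pathGaps_mono A hw
    have hm2 := pathGaps_succ A w
    have hw' : pathMem A w := by
      by_contra hc
      rw [if_neg hc] at hm2
      omega
    rw [if_pos hw'] at hm2
    refine (ih (by omega) trivial (by omega)).trans (SimpleGraph.Adj.reachable ?_)
    rw [thickCycle_restrict_adj]
    exact ⟨fun h => by simpa using congrArg (fun z => z.1.val) h, Or.inl ⟨hw', rfl⟩⟩

/-- Gap counts start at 0 and grow by steps of at most 1, so they skip no value. -/
theorem exists_pathGaps_eq {n j : ℕ} (A : Set (Fin (n - 1) ⊕ Fin j)) {N k : ℕ}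
    (h : k ≤ pathGaps A N) : ∃ v ≤ N, pathGaps A v = k := by
  induction N with
  | zero => exact ⟨0, le_rfl, by rw [pathGaps_zero] at *; omega⟩
  | succ N ih =>
    by_cases hk : k ≤ pathGaps A N
    · obtain ⟨v, hv, h'⟩ := ih hk
      exact ⟨v, by omega, h'⟩
    · refine ⟨N + 1, le_rfl, ?_⟩
      rw [pathGaps_succ] at h ⊢
      split_ifs at h ⊢ <;> omega

/-- Vertices are labelled by their gap count `s`. Without parallel edges the components are its
level sets. Any parallel edge identifies the labels of the two ends, so the components become labels
modulo the total number of gaps; `max 1` covers the case of no gap. -/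
theorem thickCycle_numComponents {n j : ℕ} (hn : 1 ≤ n) (A : Finset (Fin (n - 1) ⊕ Fin j)) :
    ((thickCycle n j).restrict (A : Set (Fin (n - 1) ⊕ Fin j))).numComponents =
      if A.toRight.card = 0 then n - A.toLeft.card else max 1 (n - 1 - A.toLeft.card) := by
  classical
  have hcount := pathGaps_add_card A
  set s := pathGaps (A : Set (Fin (n - 1) ⊕ Fin j)) with hs
  have hcard : A.toLeft.card ≤ n - 1 := by omega
  have hchord : (∃ l, Sum.inr l ∈ (A : Set (Fin (n - 1) ⊕ Fin j))) ↔ A.toRight.card ≠ 0 := by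
    rw [Finset.card_ne_zero]
    exact ⟨fun ⟨l, hl⟩ => ⟨l, by simpa using hl⟩, fun ⟨l, hl⟩ => ⟨l, by simpa using hl⟩⟩
  have hle : ∀ v : Fin n, s v ≤ s (n - 1) :=
    fun v => pathGaps_mono _ (by omega)
  have hstep : ∀ u v : ((thickCycle n j).restrict (A : Set (Fin (n - 1) ⊕ Fin j))).vertexSet,
      pathMem (A : Set (Fin (n - 1) ⊕ Fin j)) u.1.val → v.1.val = u.1.val + 1 →
      s u.1.val = s v.1.val := by
    intro u v hu huv
    rw [huv, hs, pathGaps_succ, if_pos hu, add_zero]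
  unfold Graph.numComponents
  split_ifs with hq
  · refine SimpleGraph.card_connectedComponent_eq _
      (fun v => ⟨s v.1.val, by have := hle v.1; omega⟩) ?_ ?_
    · rintro ⟨k, hk⟩
      obtain ⟨v, hv, h⟩ := exists_pathGaps_eq (A : Set (Fin (n - 1) ⊕ Fin j)) (N := n - 1) (k := k)
        (by rw [← hs]; omega)
      exact ⟨⟨⟨v, by omega⟩, trivial⟩, by simpa using h⟩
    · intro u v
      rw [Fin.mk.injEq]
      refine ⟨fun h => SimpleGraph.map_eq_of_reachable (f := fun v => s v.1.val) ?_ h,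
        reachable_of_pathGaps_eq _ u v⟩
      intro u v huv
      rw [thickCycle_restrict_adj, hchord] at huv
      rcases huv with ⟨-, ⟨h1, h2⟩ | ⟨h1, h2⟩ | ⟨h1, -⟩⟩
      · exact hstep u v h1 h2
      · exact (hstep v u h1 h2).symm
      · exact absurd hq h1
  · set N := max 1 (n - 1 - A.toLeft.card) with hN
    have hN0 : 0 < N := by omega
    refine SimpleGraph.card_connectedComponent_eq _
      (fun v => ⟨s v.1.val % N, Nat.mod_lt _ hN0⟩) ?_ ?_
    · rintro ⟨k, hk⟩
      obtain ⟨v, hv, h⟩ := exists_pathGaps_eq (A : Set (Fin (n - 1) ⊕ Fin j)) (N := n - 1) (k := k)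
        (by rw [← hs]; omega)
      exact ⟨⟨⟨v, by omega⟩, trivial⟩, by simpa [hs, h] using Nat.mod_eq_of_lt hk⟩
    · have hends : s (n - 1) % N = 0 := by
        rcases Nat.eq_zero_or_pos (s (n - 1)) with h | h
        · simp [h]
        · rw [show N = s (n - 1) by omega, Nat.mod_self]
      intro u v
      rw [Fin.mk.injEq]
      refine ⟨fun h => SimpleGraph.map_eq_of_reachable
        (f := fun v => s v.1.val % N) ?_ h, fun h => ?_⟩
      · intro u v huv
        rw [thickCycle_restrict_adj] at huv
        rcases huv with ⟨-, ⟨h1, h2⟩ | ⟨h1, h2⟩ | ⟨-, ⟨h1, h2⟩ | ⟨h1, h2⟩⟩⟩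
        · simp only [hstep u v h1 h2]
        · simp only [hstep v u h1 h2]
        · rw [h1, h2, hends, hs, pathGaps_zero, Nat.zero_mod]
        · rw [h1, h2, hends, hs, pathGaps_zero, Nat.zero_mod]
      · wlog huv : s u.1.val ≤ s v.1.val generalizing u v
        · exact (this v u h.symm (by omega)).symm
        rcases huv.eq_or_lt with he | hlt
        · exact reachable_of_pathGaps_eq _ u v he
        have hv := hle v.1
        -- Labels lie between 0 and `N`, so two different ones congruent modulo `N` are `0` and `N`,
        -- which the extra edge joins.
        have hvN : s v.1.val = N ∧ s u.1.val = 0 := by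
          rcases (show s v.1.val < N ∨ s v.1.val = N by omega) with h1 | h1
          · rw [Nat.mod_eq_of_lt h1, Nat.mod_eq_of_lt (by omega)] at h
            omega
          · rw [h1, Nat.mod_self, Nat.mod_eq_of_lt (by omega)] at h
            exact ⟨h1, h⟩
        let a : ((thickCycle n j).restrict (A : Set (Fin (n - 1) ⊕ Fin j))).vertexSet :=
          ⟨⟨0, by omega⟩, trivial⟩
        let b : ((thickCycle n j).restrict (A : Set (Fin (n - 1) ⊕ Fin j))).vertexSet :=
          ⟨⟨n - 1, by omega⟩, trivial⟩
        have hua := reachable_of_pathGaps_eq _ u a (hvN.2.trans (pathGaps_zero _).symm)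
        have hbv := reachable_of_pathGaps_eq _ b v (show s (n - 1) = s v.1.val by omega)
        -- For `n = 1` the extra edge is a loop and both ends coincide.
        by_cases hab : a = b
        · exact hua.trans (hab ▸ hbv)
        · refine hua.trans ((SimpleGraph.Adj.reachable ?_).trans hbv)
          rw [thickCycle_restrict_adj]
          exact ⟨hab, Or.inr (Or.inr ⟨hchord.2 hq, Or.inl ⟨rfl, rfl⟩⟩)⟩

theorem thickCycle_edgeRank {n j : ℕ} (hn : 1 ≤ n) (A : Finset (Fin (n - 1) ⊕ Fin j)) :
    (thickCycle n j).edgeRank (A : Set (Fin (n - 1) ⊕ Fin j)) =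
      if A.toRight.card = 0 then A.toLeft.card else min (n - 1) (A.toLeft.card + 1) := by
  have h1 : A.toLeft.card ≤ n - 1 := by simpa using A.toLeft.card_le_univ
  have h2 : (thickCycle n j).vertexSet.ncard = n := by
    change (Set.univ : Set (Fin n)).ncard = n
    simp [Set.ncard_univ]
  rw [Graph.edgeRank, thickCycle_numComponents hn, h2]
  split_ifs <;> omega

/-! ### Closed form of the Tutte polynomial. -/

theorem mul_sum_choose_pred {R : Type*} [CommRing R] (a : R) (m : ℕ) :
    a * ∑ q ∈ Finset.range m, m.choose (q + 1) • a ^ q = (a + 1) ^ m - 1 := by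
  rw [add_pow, Finset.sum_range_succ', Finset.mul_sum]
  simp only [pow_zero, one_pow, mul_one, Nat.choose_zero_right, Nat.cast_one, add_sub_cancel_right]
  refine Finset.sum_congr rfl fun q _ => ?_
  rw [nsmul_eq_mul]
  ring

theorem sum_choose_pred {R : Type*} [CommRing R] [IsDomain R] (a : R) (ha : a ≠ 0) (m : ℕ) :
    ∑ q ∈ Finset.range m, m.choose (q + 1) • a ^ q = ∑ i ∈ Finset.range m, (a + 1) ^ i := by
  refine mul_left_cancel₀ ha ?_
  rw [mul_sum_choose_pred, ← geom_sum_mul]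
  ring

/-- The Tutte polynomial of `C_{m+1}^j`. -/
def thickCyclePoly (m j : ℕ) : ℤ[X][X] :=
  X ^ m + C (∑ i ∈ Finset.range j, X ^ i) * (∑ i ∈ Finset.range (m - 1), X ^ (i + 1) + C X)

/-- Edge sets are grouped by the number `p` of path edges and `q` of parallel edges, with `a = x -
1` and `b = y - 1`. For `p < m` the first parallel edge raises the rank and each further one gives a
factor `b`; for `p = m` the rank is already full and every one of them gives a factor `b`. -/
theorem sum_tutte_terms {R : Type*} [CommRing R] [IsDomain R] (a b : R) (ha : a ≠ 0) (hb : b ≠ 0)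
    (m j : ℕ) (hm : 1 ≤ m) :
    ∑ p ∈ Finset.range (m + 1), m.choose p • ∑ q ∈ Finset.range (j + 1), j.choose q •
      (a ^ (m - if q = 0 then p else min m (p + 1)) *
        b ^ (p + q - if q = 0 then p else min m (p + 1))) =
    (a + 1) ^ m + (∑ i ∈ Finset.range j, (b + 1) ^ i) *
      (∑ i ∈ Finset.range (m - 1), (a + 1) ^ (i + 1) + (b + 1)) := by
  have hP : ∑ p ∈ Finset.range m, m.choose p • a ^ (m - 1 - p) =
      ∑ i ∈ Finset.range m, (a + 1) ^ i := by
    rw [← sum_choose_pred a ha, ← Finset.sum_range_reflect]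
    refine Finset.sum_congr rfl fun p hp => ?_
    rw [Finset.mem_range] at hp
    rw [← Nat.choose_symm (by omega)]
    congr 3 <;> omega
  have h1 : ∀ p ∈ Finset.range m, m.choose p • ∑ q ∈ Finset.range (j + 1), j.choose q •
      (a ^ (m - if q = 0 then p else min m (p + 1)) *
        b ^ (p + q - if q = 0 then p else min m (p + 1))) =
      m.choose p • a ^ (m - p) + (m.choose p • a ^ (m - 1 - p)) *
        ∑ i ∈ Finset.range j, (b + 1) ^ i := by
    intro p hp
    rw [Finset.mem_range] at hp
    rw [Finset.sum_range_succ', ← sum_choose_pred b hb, smul_mul_assoc, ← smul_add]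
    congr 1
    rw [add_comm]
    congr 1
    · simp
    · rw [Finset.mul_sum]
      refine Finset.sum_congr rfl fun q _ => ?_
      rw [mul_smul_comm, if_neg (by omega), min_eq_right (by omega)]
      congr 3 <;> omega
  have h2 : ∑ q ∈ Finset.range (j + 1), j.choose q •
      (a ^ (m - if q = 0 then m else min m (m + 1)) *
        b ^ (m + q - if q = 0 then m else min m (m + 1))) =
      1 + b * ∑ i ∈ Finset.range j, (b + 1) ^ i := by
    rw [Finset.sum_range_succ', ← sum_choose_pred b hb, add_comm]
    congr 1
    · simp
    · rw [Finset.mul_sum]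
      refine Finset.sum_congr rfl fun q _ => ?_
      rw [mul_smul_comm, if_neg (by omega), min_eq_left (by omega), Nat.sub_self, pow_zero,
        one_mul, Nat.add_sub_cancel_left, pow_succ']
  have h3 : (a + 1) ^ m = ∑ p ∈ Finset.range m, m.choose p • a ^ (m - p) + 1 := by
    rw [add_comm a, add_pow, Finset.sum_range_succ]
    simp [mul_comm]
  rw [Finset.sum_range_succ, Finset.sum_congr rfl h1, Finset.sum_add_distrib, ← Finset.sum_mul, hP,
    Nat.choose_self, one_smul, h2, h3]
  obtain ⟨k, rfl⟩ : ∃ k, m = k + 1 := ⟨m - 1, by omega⟩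
  rw [Nat.add_sub_cancel, Finset.sum_range_succ' (fun i => (a + 1) ^ i) k, pow_zero]
  ring

theorem tuttePoly_thickCycle (n j : ℕ) (hn : 2 ≤ n) :
    (thickCycle n j).tuttePoly = thickCyclePoly (n - 1) j := by
  classical
  have hX : (X - 1 : ℤ[X][X]) ≠ 0 := X_sub_C_ne_zero 1
  have hC : (C X - 1 : ℤ[X][X]) ≠ 0 := by
    rw [← C_1, ← C_sub, Ne, C_eq_zero]
    exact X_sub_C_ne_zero 1
  have hE : (thickCycle n j).edgeRank (thickCycle n j).edgeSet = n - 1 := by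
    rw [thickCycle_edgeSet n j (by omega), ← Finset.coe_univ, thickCycle_edgeRank (by omega)]
    simp
  rw [Graph.tuttePoly, thickCycle_edgeSet n j (by omega)] at *
  rw [hE]
  simp only [Set.subset_univ, Finset.filter_true]
  rw [Fintype.sum_equiv Finset.sumEquiv.toEquiv _ (fun S : Finset (Fin (n - 1)) × Finset (Fin j) =>
      (X - 1 : ℤ[X][X]) ^ (n - 1 - if S.2.card = 0 then S.1.card else min (n - 1) (S.1.card + 1)) *
        (C X - 1) ^ (S.1.card + S.2.card - if S.2.card = 0 then S.1.card else
          min (n - 1) (S.1.card + 1))), Fintype.sum_prod_type]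
  · have key := sum_tutte_terms (X - 1 : ℤ[X][X]) (C X - 1) hX hC (n - 1) j (by omega)
    rw [sub_add_cancel, sub_add_cancel] at key
    rw [thickCyclePoly, map_sum]
    simp only [C_pow]
    rw [← key]
    have h1 := Finset.sum_powerset_apply_card (fun p => ∑ q ∈ Finset.range (j + 1), j.choose q •
      ((X - 1 : ℤ[X][X]) ^ (n - 1 - if q = 0 then p else min (n - 1) (p + 1)) *
        (C X - 1) ^ (p + q - if q = 0 then p else min (n - 1) (p + 1))))
        (x := (Finset.univ : Finset (Fin (n - 1))))
    rw [Finset.powerset_univ, Finset.card_univ, Fintype.card_fin] at h1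
    rw [← h1]
    refine Finset.sum_congr rfl fun S _ => ?_
    have h2 := Finset.sum_powerset_apply_card (fun q =>
      ((X - 1 : ℤ[X][X]) ^ (n - 1 - if q = 0 then S.card else min (n - 1) (S.card + 1)) *
        (C X - 1) ^ (S.card + q - if q = 0 then S.card else min (n - 1) (S.card + 1))))
        (x := (Finset.univ : Finset (Fin j)))
    rw [Finset.powerset_univ, Finset.card_univ, Fintype.card_fin] at h2
    exact h2
  · intro A
    rw [thickCycle_edgeRank (by omega), ← A.card_toLeft_add_card_toRight]
    rfl

/-! ### The specialization at `y = -1`. -/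

/-- The polynomial `x^m + ⋯ + x - 1`. -/
def bonacci (m : ℕ) : ℤ[X] := X ^ m + ∑ i ∈ Finset.range (m - 1), X ^ (i + 1) - 1

theorem X_pow_add_sum_eq_sum {R : Type*} [CommRing R] {m : ℕ} (hm : 1 ≤ m) (x : R) :
    x ^ m + ∑ i ∈ Finset.range (m - 1), x ^ (i + 1) = ∑ i ∈ Finset.range m, x ^ (i + 1) := by
  obtain ⟨k, rfl⟩ : ∃ k, m = k + 1 := ⟨m - 1, by omega⟩
  rw [Finset.sum_range_succ, Nat.add_sub_cancel, add_comm]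

theorem bonacci_eq {m : ℕ} (hm : 1 ≤ m) :
    bonacci m = ∑ i ∈ Finset.range m, X ^ (i + 1) - 1 := by
  rw [bonacci, X_pow_add_sum_eq_sum hm]

/-- The trinomial on the right is what makes multiple roots and the discriminant computable by hand.
-/
theorem X_sub_one_mul_bonacci {m : ℕ} (hm : 1 ≤ m) :
    (X - 1) * bonacci m = X ^ (m + 1) - 2 * X + 1 := by
  rw [bonacci_eq hm]
  simp only [pow_succ]
  rw [← Finset.sum_mul]
  linear_combination X * mul_geom_sum (X : ℤ[X]) m

theorem degree_sum_X_pow_lt {R : Type*} [CommRing R] {m : ℕ} (hm : 1 ≤ m) :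
    (∑ i ∈ Finset.range (m - 1), (X : R[X]) ^ (i + 1)).degree < m := by
  refine (degree_sum_le _ _).trans_lt ((Finset.sup_lt_iff (by simp)).2 fun i hi => ?_)
  rw [Finset.mem_range] at hi
  exact (degree_X_pow_le _).trans_lt (by exact_mod_cast (by omega : i + 1 < m))

theorem bonacci_tail_degree {m : ℕ} (hm : 1 ≤ m) :
    (∑ i ∈ Finset.range (m - 1), (X : ℤ[X]) ^ (i + 1) - 1).degree < m := by
  refine (degree_sub_le _ _).trans_lt (max_lt (degree_sum_X_pow_lt hm) ?_)
  rw [degree_one]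
  exact_mod_cast hm

theorem bonacci_monic {m : ℕ} (hm : 1 ≤ m) : (bonacci m).Monic := by
  rw [bonacci, add_sub_assoc]
  exact monic_X_pow_add (bonacci_tail_degree hm)

theorem bonacci_natDegree {m : ℕ} (hm : 1 ≤ m) : (bonacci m).natDegree = m := by
  rw [bonacci, add_sub_assoc]
  refine natDegree_eq_of_degree_eq_some ?_
  rw [degree_add_eq_left_of_degree_lt, degree_X_pow]
  rw [degree_X_pow]
  exact bonacci_tail_degree hm

theorem map_X_sub_one_mul_bonacci {R : Type*} [CommRing R] {m : ℕ} (hm : 1 ≤ m) :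
    (X - 1) * (bonacci m).map (Int.castRingHom R) = X ^ (m + 1) - 2 * X + 1 := by
  have h := congrArg (Polynomial.map (Int.castRingHom R)) (X_sub_one_mul_bonacci hm)
  simpa using h

/-! ### Multiple roots over an arbitrary field. -/

section Collision

variable {κ : Type*} [Field κ]

theorem pow_count_dvd_prod [DecidableEq κ] (s : Multiset κ) (r : κ) {k : ℕ} (hk : k ≤ s.count r) :
    (X - C r) ^ k ∣ (s.map fun r => X - C r).prod := by
  rw [Multiset.le_count_iff_replicate_le] at hk
  have h := Multiset.prod_dvd_prod_of_le (Multiset.map_le_map (f := fun r => X - C r) hk)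
  simpa using h

/-- The trinomial and its derivative both vanish at a double root; eliminating the powers of `r`
leaves a linear equation, hence at most one candidate. -/
theorem two_mul_root_eq {m : ℕ} (hm : 1 ≤ m) {r : κ}
    (hr : (X - C r) ^ 2 ∣ (bonacci m).map (Int.castRingHom κ)) :
    r ^ (m + 1) - 2 * r + 1 = 0 ∧ (m + 1) * r ^ m = 2 ∧ 2 * (m : κ) * r = m + 1 := by
  have h1 : (X - C r) ^ 2 ∣ (X ^ (m + 1) - 2 * X + 1 : κ[X]) :=
    map_X_sub_one_mul_bonacci (R := κ) hm ▸ hr.mul_left _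
  have h2 := pow_sub_one_dvd_derivative_of_pow_dvd h1
  rw [show 2 - 1 = 1 from rfl, pow_one, dvd_iff_isRoot] at h2
  have e1 := dvd_iff_isRoot.1 ((dvd_pow_self _ two_ne_zero).trans h1)
  simp only [IsRoot.def, eval_add, eval_sub, eval_mul, eval_pow, eval_X, eval_one,
    eval_ofNat] at e1
  simp only [derivative_add, derivative_sub, derivative_mul, derivative_X_pow, derivative_X,
    derivative_one, derivative_ofNat, IsRoot.def, eval_add, eval_sub, eval_mul, eval_pow, eval_X,
    eval_one, eval_ofNat, Nat.cast_add, Nat.cast_one, Nat.add_sub_cancel, eval_zero,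
    C_add, C_1, eval_natCast, map_natCast] at h2
  refine ⟨e1, by linear_combination h2, by linear_combination r * h2 - (m + 1) * e1⟩

theorem bonacci_collision_unique {m : ℕ} (hm : 1 ≤ m) (h2 : (2 : κ) ≠ 0) {r r' : κ}
    (hr : (X - C r) ^ 2 ∣ (bonacci m).map (Int.castRingHom κ))
    (hr' : (X - C r') ^ 2 ∣ (bonacci m).map (Int.castRingHom κ)) : r = r' := by
  have h := (two_mul_root_eq hm hr).2.2
  have h' := (two_mul_root_eq hm hr').2.2
  have hm0 : (m : κ) ≠ 0 := fun h0 => by simp [h0] at h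
  exact mul_left_cancel₀ (mul_ne_zero h2 hm0) (h.trans h'.symm)

/-- A triple root would also kill the second derivative `(m + 1) m r^(m-1)`, while the relations at
a double root make each of its factors nonzero. -/
theorem bonacci_no_triple {m : ℕ} (hm : 1 ≤ m) (h2 : (2 : κ) ≠ 0) {r : κ} :
    ¬ (X - C r) ^ 3 ∣ (bonacci m).map (Int.castRingHom κ) := by
  intro h3
  obtain ⟨e1, e2, e3⟩ := two_mul_root_eq hm ((pow_dvd_pow _ (by norm_num : 2 ≤ 3)).trans h3)
  have hm0 : (m : κ) ≠ 0 := fun h0 => by simp [h0] at e3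
  have h3' : (X - C r) ^ 3 ∣ (X ^ (m + 1) - 2 * X + 1 : κ[X]) :=
    map_X_sub_one_mul_bonacci (R := κ) hm ▸ h3.mul_left _
  have h := pow_sub_one_dvd_derivative_of_pow_dvd (pow_sub_one_dvd_derivative_of_pow_dvd h3')
  rw [show 3 - 1 - 1 = 1 from rfl, pow_one, dvd_iff_isRoot] at h
  simp only [derivative_add, derivative_sub, derivative_mul, derivative_X_pow, derivative_X,
    derivative_one, derivative_ofNat, IsRoot.def, eval_add, eval_sub, eval_mul, eval_pow, eval_X,
    eval_one, eval_ofNat, Nat.cast_add, Nat.cast_one, Nat.add_sub_cancel, eval_zero,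
    C_add, C_1, eval_natCast, map_natCast, derivative_natCast, derivative_zero] at h
  have e' : (m + 1 : κ) * (m * r ^ (m - 1)) = 0 := by linear_combination h
  have hm1 : (m + 1 : κ) ≠ 0 := fun h0 => by
    rw [h0, zero_mul] at e2
    exact h2 e2.symm
  rcases mul_eq_zero.1 ((mul_eq_zero.1 e').resolve_left hm1) with h0 | h0
  · exact hm0 h0
  · have hr0 : r = 0 := eq_zero_of_pow_eq_zero h0
    rw [hr0] at e1
    simp at e1

theorem card_le_card_toFinset_add_one_of_bonacci [DecidableEq κ] {m : ℕ} (hm : 1 ≤ m)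
    (h2 : (2 : κ) ≠ 0) {s : Multiset κ}
    (hs : (bonacci m).map (Int.castRingHom κ) = (s.map fun r => X - C r).prod) :
    s.card ≤ s.toFinset.card + 1 := by
  by_cases hn : s.Nodup
  · rw [Multiset.toFinset_card_of_nodup hn]
    omega
  · rw [Multiset.nodup_iff_count_le_one] at hn
    push Not at hn
    obtain ⟨r, hr⟩ := hn
    have hd : ∀ {r' k}, k ≤ s.count r' → (X - C r') ^ k ∣ (bonacci m).map (Int.castRingHom κ) :=
      fun h => hs ▸ pow_count_dvd_prod s _ h
    have hn' : (s.erase r).Nodup := by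
      rw [Multiset.nodup_iff_count_le_one]
      intro a
      by_contra hc
      by_cases ha : a = r
      · subst ha
        rw [Multiset.count_erase_self] at hc
        exact bonacci_no_triple hm h2 (hd (by omega : 3 ≤ s.count a))
      · rw [Multiset.count_erase_of_ne ha] at hc
        exact ha (bonacci_collision_unique hm h2 (hd (by omega)) (hd hr))
    have hmem : r ∈ s := Multiset.count_pos.1 (by omega)
    have h3 := Multiset.toFinset_card_of_nodup hn'
    rw [Multiset.card_erase_of_mem hmem] at h3
    have h4 : (s.erase r).toFinset.card ≤ s.toFinset.card :=
      Finset.card_le_card (Multiset.toFinset_subset.2 (Multiset.erase_subset r s))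
    rw [h3] at h4
    exact Nat.le_add_of_sub_le h4

/-- In characteristic 2 with `m` even, the derivative relation `(m + 1) r^m = 2` becomes `r^m = 0`,
but `0` is not a root. -/
theorem bonacci_nodup_of_even [DecidableEq κ] {m : ℕ} (hm : 1 ≤ m) (hme : Even m)
    (h2 : (2 : κ) = 0) {s : Multiset κ}
    (hs : (bonacci m).map (Int.castRingHom κ) = (s.map fun r => X - C r).prod) : s.Nodup := by
  rw [Multiset.nodup_iff_count_le_one]
  intro r
  by_contra hc
  obtain ⟨e1, e2, -⟩ := two_mul_root_eq hm (hs ▸ pow_count_dvd_prod s r (by omega : 2 ≤ s.count r))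
  obtain ⟨l, rfl⟩ := hme
  have hr0 : r = 0 := by
    refine eq_zero_of_pow_eq_zero (n := l + l) ?_
    push_cast at e2
    linear_combination e2 + (1 - l * r ^ (l + l)) * h2
  rw [hr0] at e1
  simp at e1

theorem card_le_card_toFinset_add_one_of_bonacci' [DecidableEq κ] {m : ℕ} (hm : 1 ≤ m)
    (h2 : (2 : κ) ≠ 0 ∨ Even m) {s : Multiset κ}
    (hs : (bonacci m).map (Int.castRingHom κ) = (s.map fun r => X - C r).prod) :
    s.card ≤ s.toFinset.card + 1 := by
  by_cases h : (2 : κ) = 0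
  · rw [Multiset.toFinset_card_of_nodup
      (bonacci_nodup_of_even hm (h2.resolve_left fun h' => h' h) h hs)]
    omega
  · exact card_le_card_toFinset_add_one_of_bonacci hm h hs

end Collision

/-! ### Irreducibility over the integers. -/

section Irreducible

theorem bonacci_eval_eq_zero_iff {R : Type*} [CommRing R] {m : ℕ} (hm : 1 ≤ m) (x : R) :
    ((bonacci m).map (Int.castRingHom R)).IsRoot x ↔ ∑ i ∈ Finset.range m, x ^ (i + 1) = 1 := by
  rw [bonacci_eq hm]
  simp [Polynomial.map_sum, eval_finsetSum, sub_eq_zero]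

/-- Put `t = ‖z‖`. The triangle inequality gives `∑ t^(i+1) ≥ 1`, while `2z = 1 + z^(m+1)` gives `2t
≤ 1 + t^(m+1)`, which for `t < 1` means `∑ t^(i+1) ≤ 1`. Equality forces `z = t`. If `t = 1`, then
`z` and `2z - 1` both lie on the unit circle, so `z = 1`, which is no root for `m ≥ 2`. -/
theorem root_eq_norm {m : ℕ} (hm : 2 ≤ m) {z : ℂ} (hz : ∑ i ∈ Finset.range m, z ^ (i + 1) = 1)
    (h1 : ‖z‖ ≤ 1) : z = ‖z‖ ∧ ∑ i ∈ Finset.range m, ‖z‖ ^ (i + 1) = 1 := by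
  set t := ‖z‖ with ht
  have hgeom : ∀ {R : Type} [CommRing R] (x : R), (x - 1) * ∑ i ∈ Finset.range m, x ^ (i + 1) =
      x ^ (m + 1) - x := by
    intro R _ x
    simp only [pow_succ]
    rw [← Finset.sum_mul]
    linear_combination x * mul_geom_sum x m
  have hz' : z ^ (m + 1) = 2 * z - 1 := by
    have := hgeom z
    rw [hz] at this
    linear_combination -this
  have hre : ∑ i ∈ Finset.range m, (z ^ (i + 1)).re = 1 := by
    rw [← Complex.re_sum, hz, Complex.one_re]
  have hle : ∀ i ∈ Finset.range m, (z ^ (i + 1)).re ≤ t ^ (i + 1) := fun i _ => by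
    rw [ht, ← norm_pow]
    exact Complex.re_le_norm _
  have hge : 1 ≤ ∑ i ∈ Finset.range m, t ^ (i + 1) := hre ▸ Finset.sum_le_sum hle
  have h2 : 2 * t ≤ 1 + t ^ (m + 1) := by
    have h3 : ‖2 * z‖ ≤ ‖(1 : ℂ)‖ + ‖z ^ (m + 1)‖ := by
      rw [show 2 * z = 1 + z ^ (m + 1) by rw [hz']; ring]
      exact norm_add_le _ _
    simpa [norm_pow] using h3
  have hsum : ∑ i ∈ Finset.range m, t ^ (i + 1) = 1 ∨ t = 1 := by
    rcases h1.lt_or_eq with hlt | heq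
    · left
      refine le_antisymm ?_ hge
      have := hgeom t
      nlinarith
    · exact Or.inr heq
  have hzt : z.re = t → z = t := fun h => by
    have h3 := Complex.sq_norm z
    rw [Complex.normSq_apply, ← ht, h] at h3
    have h4 : z.im = 0 := by nlinarith
    exact Complex.ext (by simp [h]) (by simp [h4])
  rcases hsum with hsum | h1'
  · refine ⟨hzt ?_, hsum⟩
    have := (Finset.sum_eq_sum_iff_of_le hle).1 (hre.trans hsum.symm) 0
      (Finset.mem_range.2 (by omega))
    simpa using this
  · exfalso
    have h3 : ‖2 * z - 1‖ = 1 := by rw [← hz', norm_pow, ← ht, h1', one_pow]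
    have h4 := Complex.sq_norm z
    have h5 := Complex.sq_norm (2 * z - 1)
    rw [Complex.normSq_apply] at h4 h5
    rw [h3] at h5
    rw [← ht, h1'] at h4
    simp at h5
    have h6 : z.re = t := by rw [h1']; nlinarith
    rw [hzt h6, h1'] at hz
    have h7 : (m : ℂ) = 1 := by simpa using hz
    have : m = 1 := by exact_mod_cast h7
    omega

theorem one_lt_norm_multiset_prod {s : Multiset ℂ} (h0 : s ≠ 0) (h : ∀ z ∈ s, 1 < ‖z‖) :
    1 < ‖s.prod‖ := by
  induction s using Multiset.induction with
  | empty => exact absurd rfl h0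
  | cons a s ih =>
    rw [Multiset.prod_cons, norm_mul]
    have ha := h a (Multiset.mem_cons_self a s)
    by_cases hs : s = 0
    · simpa [hs] using ha
    · exact one_lt_mul_of_lt_of_le ha (ih hs fun z hz => h z (Multiset.mem_cons_of_mem hz)).le

/-- The product of the roots is, up to sign, the constant term, a unit. -/
theorem exists_root_norm_le_one {p : ℤ[X]} (hp : p.Monic) (hd : p.natDegree ≠ 0)
    (h0 : p.coeff 0 ∣ 1) : ∃ z : ℂ, (p.map (Int.castRingHom ℂ)).IsRoot z ∧ ‖z‖ ≤ 1 := by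
  by_contra! hc
  have hs := IsAlgClosed.splits (p.map (Int.castRingHom ℂ))
  have hprod := hs.coeff_zero_eq_prod_roots_of_monic (hp.map _)
  have hlt : 1 < ‖(p.map (Int.castRingHom ℂ)).roots.prod‖ := by
    refine one_lt_norm_multiset_prod ?_ fun z hz => hc z (isRoot_of_mem_roots hz)
    intro h
    have := hs.natDegree_eq_card_roots
    rw [h, hp.natDegree_map] at this
    exact hd (by simpa using this)
  have hn : ‖(p.map (Int.castRingHom ℂ)).coeff 0‖ = 1 := by
    rw [coeff_map]
    rcases Int.isUnit_iff.1 (isUnit_of_dvd_one h0) with h | h <;> simp [h]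
  rw [hprod, norm_mul, norm_pow, norm_neg, norm_one, one_pow, one_mul] at hn
  exact hlt.ne' hn

theorem bonacci_coeff_zero {m : ℕ} (hm : 1 ≤ m) : (bonacci m).coeff 0 = -1 := by
  rw [bonacci_eq hm]
  simp [coeff_X_pow]

/-- In a factorization both monic factors have constant term `±1`, hence a root in the closed unit
disc. By `root_eq_norm` both are the unique positive root, which would be a double root of the
product; but the derivative is positive there. -/
theorem bonacci_irreducible {m : ℕ} (hm : 2 ≤ m) : Irreducible (bonacci m) := by
  have hmon := bonacci_monic (m := m) (by omega)
  rw [hmon.irreducible_iff_natDegree]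
  refine ⟨fun h => ?_, fun p q hp hq hpq => ?_⟩
  · have := bonacci_natDegree (m := m) (by omega)
    rw [h, natDegree_one] at this
    omega
  by_contra! hc
  have h0 : p.coeff 0 * q.coeff 0 = -1 := by
    rw [← mul_coeff_zero, hpq, bonacci_coeff_zero (by omega)]
  obtain ⟨z, hz, hz1⟩ := exists_root_norm_le_one hp hc.1 ⟨-q.coeff 0, by linear_combination h0⟩
  obtain ⟨w, hw, hw1⟩ := exists_root_norm_le_one hq hc.2 ⟨-p.coeff 0, by linear_combination h0⟩
  have hroot : ∀ {z : ℂ}, (p.map (Int.castRingHom ℂ)).IsRoot z ∨ (q.map (Int.castRingHom ℂ)).IsRoot z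
      → ∑ i ∈ Finset.range m, z ^ (i + 1) = 1 := by
    intro z h
    rw [← bonacci_eval_eq_zero_iff (by omega), ← hpq, Polynomial.map_mul]
    rcases h with h | h
    · exact root_mul_right_of_isRoot _ h
    · exact root_mul_left_of_isRoot _ h
  obtain ⟨ez, sz⟩ := root_eq_norm hm (hroot (Or.inl hz)) hz1
  obtain ⟨ew, sw⟩ := root_eq_norm hm (hroot (Or.inr hw)) hw1
  have hmono : StrictMonoOn (fun t : ℝ => ∑ i ∈ Finset.range m, t ^ (i + 1)) (Set.Ici 0) := by
    intro a ha b hb hab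
    refine Finset.sum_lt_sum_of_nonempty ⟨0, Finset.mem_range.2 (by omega)⟩ fun i _ => ?_
    exact pow_lt_pow_left₀ hab ha (by omega)
  have hzw : ‖z‖ = ‖w‖ := hmono.injOn (norm_nonneg z) (norm_nonneg w) (sz.trans sw.symm)
  have hzw' : z = w := by rw [ez, ew, hzw]
  subst hzw'
  have hsq : (X - C z) ^ 2 ∣ (bonacci m).map (Int.castRingHom ℂ) := by
    rw [← hpq, Polynomial.map_mul, sq]
    exact mul_dvd_mul (dvd_iff_isRoot.2 hz) (dvd_iff_isRoot.2 hw)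
  have hd := dvd_iff_isRoot.1 (by simpa using pow_sub_one_dvd_derivative_of_pow_dvd hsq)
  rw [bonacci_eq (by omega)] at hd
  simp only [derivative_sub, derivative_sum, derivative_X_pow, derivative_one,
    sub_zero, Polynomial.map_sum, Polynomial.map_mul, Polynomial.map_pow, map_X, IsRoot.def,
    eval_finsetSum, eval_mul, eval_pow, eval_X, Nat.add_sub_cancel, map_natCast,
    Polynomial.map_natCast, eval_natCast] at hd
  rw [ez] at hd
  have hd' : ∑ i ∈ Finset.range m, ((i + 1 : ℕ) : ℝ) * ‖z‖ ^ i = 0 := by exact_mod_cast hd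
  have h0' := (Finset.sum_eq_zero_iff_of_nonneg (fun i _ => by positivity)).1 hd' 0
    (Finset.mem_range.2 (by omega))
  simp at h0'

end Irreducible

/-! ### The discriminant and its 2-adic valuation. -/

/-- The resultant of a polynomial and its derivative: for a monic polynomial, the discriminant up
to sign. -/
def derivRes {R : Type*} [CommRing R] (f : R[X]) : R :=
  resultant f (derivative f) f.natDegree (f.natDegree - 1)

/-- This is why the second size in `derivRes` is `natDegree - 1` and not the degree of the
derivative, which can drop in positive characteristic. -/
theorem derivRes_map {R S : Type*} [CommRing R] [CommRing S] [Nontrivial S] (φ : R →+* S) {f : R[X]}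
    (hf : f.Monic) : derivRes (f.map φ) = φ (derivRes f) := by
  rw [derivRes, derivRes, hf.natDegree_map, derivative_map, resultant_map_map]

theorem derivRes_eq_prod {R : Type*} [CommRing R] [IsDomain R] {f : R[X]} (hf : f.Monic)
    (hs : f.Splits) : derivRes f = (f.roots.map (derivative f).eval).prod := by
  rw [derivRes, resultant_eq_prod_eval _ _ _ (natDegree_derivative_le f) hs, hf.leadingCoeff,
    one_pow, one_mul]

theorem eval_prod_X_sub_C {R : Type*} [CommRing R] (s : Multiset R) (x : R) :
    (s.map fun r => X - C r).prod.eval x = (s.map fun r => x - r).prod := by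
  rw [eval_multiset_prod, Multiset.map_map]
  simp

/-- Differentiating the trinomial gives `r (r - 1) F'(r) = 2 m r - (m + 1)` at each root `r`. The
product over all roots expresses `F(0) F(1)` times the resultant through the value of `F` at `(m +
1) / (2 m)`, which the trinomial supplies. One factor `m - 1` comes from `F(1)`, the other from
dividing the trinomial by `x - 1` at that point. -/
theorem derivRes_bonacci_eq {m : ℕ} (hm : 2 ≤ m) :
    ((m : ℤ) - 1) ^ 2 * derivRes (bonacci m) =
      (-1) ^ m * ((m + 1) ^ (m + 1) - 2 ^ (m + 1) * m ^ m) := by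
  have hmon := bonacci_monic (m := m) (by omega)
  apply (Int.castRingHom ℂ).injective_int
  set F := (bonacci m).map (Int.castRingHom ℂ) with hF
  have hFm : F.Monic := hmon.map _
  have hs := IsAlgClosed.splits F
  have hcard : F.roots.card = m := by
    rw [← hs.natDegree_eq_card_roots, hF, hmon.natDegree_map, bonacci_natDegree (by omega)]
  have hprod : F = (F.roots.map fun r => X - C r).prod := hs.eq_prod_roots_of_monic hFm
  have hev : ∀ x : ℂ, F.eval x = (F.roots.map fun r => x - r).prod := fun x => by
    conv_lhs => rw [hprod]
    exact eval_prod_X_sub_C _ _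
  have hH : ∀ x : ℂ, (x - 1) * F.eval x = x ^ (m + 1) - 2 * x + 1 := fun x => by
    have := congrArg (eval x) (map_X_sub_one_mul_bonacci (R := ℂ) (m := m) (by omega))
    simpa using this
  have h0 : F.eval 0 = -1 := by
    have := hH 0
    simp at this
    linear_combination -this
  have h1 : F.eval 1 = m - 1 := by
    rw [hF, bonacci_eq (by omega)]
    simp [Polynomial.map_sum, eval_finsetSum]
  have hD : Int.castRingHom ℂ (derivRes (bonacci m)) = (F.roots.map (derivative F).eval).prod := by
    rw [← derivRes_map _ hmon, derivRes_eq_prod hFm hs]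
  have hroot : ∀ r ∈ F.roots, (0 - r) * (1 - r) * (derivative F).eval r = 2 * m * r - (m + 1) := by
    intro r hr
    have hr0 : F.eval r = 0 := isRoot_of_mem_roots hr
    have e1 := hH r
    rw [hr0, mul_zero] at e1
    have e2 := congrArg (fun p => (derivative p).eval r)
      (map_X_sub_one_mul_bonacci (R := ℂ) (m := m) (by omega))
    simp only [derivative_add, derivative_sub, derivative_mul, derivative_X_pow, derivative_X,
      derivative_one, derivative_ofNat, eval_add, eval_sub, eval_mul, eval_pow, eval_X, eval_one,
      eval_ofNat, Nat.cast_add, Nat.cast_one, Nat.add_sub_cancel, eval_zero, C_add, C_1,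
      eval_natCast, map_natCast] at e2
    rw [← hF, hr0] at e2
    linear_combination r * e2 - (m + 1) * e1
  have hm0 : (m : ℂ) ≠ 0 := by
    exact_mod_cast (by omega : m ≠ 0)
  have hx : (F.roots.map fun r => 2 * (m : ℂ) * r - (m + 1)).prod =
      (-(2 * (m : ℂ))) ^ m * F.eval (((m : ℂ) + 1) / (2 * m)) := by
    rw [hev, ← hcard, ← Multiset.prod_replicate, ← Multiset.map_const', ← Multiset.prod_map_mul,
      hcard]
    refine congrArg Multiset.prod (Multiset.map_congr rfl fun r _ => ?_)
    field_simp
    ring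
  have hx' := hH (((m : ℂ) + 1) / (2 * m))
  have key : F.eval 0 * F.eval 1 * Int.castRingHom ℂ (derivRes (bonacci m)) =
      (-(2 * (m : ℂ))) ^ m * F.eval (((m : ℂ) + 1) / (2 * m)) := by
    rw [← hx, hD, hev, hev, ← Multiset.prod_map_mul, ← Multiset.prod_map_mul]
    exact congrArg Multiset.prod (Multiset.map_congr rfl hroot)
  rw [h0, h1] at key
  have h2m : (2 * (m : ℂ)) ≠ 0 := mul_ne_zero two_ne_zero hm0
  have hx2 : (1 - m : ℂ) * ((2 * m) ^ m * F.eval (((m : ℂ) + 1) / (2 * m))) =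
      (m + 1) ^ (m + 1) - 2 ^ (m + 1) * m ^ m := by
    have e1 : ((m + 1 : ℂ) / (2 * m) - 1) * (2 * m) = 1 - m := by
      field_simp
      ring
    calc (1 - m : ℂ) * ((2 * m) ^ m * F.eval (((m : ℂ) + 1) / (2 * m)))
        = (2 * m) ^ (m + 1) * (((m + 1 : ℂ) / (2 * m) - 1) * F.eval (((m : ℂ) + 1) / (2 * m))) := by
          rw [← e1]; ring
      _ = (m + 1) ^ (m + 1) - 2 ^ (m + 1) * m ^ m := by
          rw [hx', div_pow]
          field_simp
          ring
  rw [neg_pow] at key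
  simp only [map_mul, map_sub, map_pow, map_neg, map_one, map_add, map_natCast, map_ofNat]
  linear_combination (-(m - 1 : ℂ)) * key + (-1) ^ m * hx2

theorem one_add_pow_eq (x : ℤ) (N : ℕ) :
    ∃ q : ℤ, (1 + x) ^ N = 1 + N * x + (N.choose 2 : ℕ) * x ^ 2 + q * x ^ 3 := by
  induction N with
  | zero => exact ⟨0, by simp⟩
  | succ N ih =>
    obtain ⟨q, hq⟩ := ih
    refine ⟨(N.choose 2 : ℕ) + q * (1 + x), ?_⟩
    have h : (N + 1).choose 2 = N + N.choose 2 := by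
      rw [Nat.choose_succ_succ' N 1, Nat.choose_one_right]
    rw [pow_succ, hq, h]
    push_cast
    ring

theorem odd_derivRes_bonacci {m : ℕ} (hm : 2 ≤ m) (he : Even m) : Odd (derivRes (bonacci m)) := by
  have h := derivRes_bonacci_eq hm
  have hme : Even (m : ℤ) := by exact_mod_cast he
  have h1 : Odd ((m : ℤ) + 1) := hme.add_one
  have h2 : Odd (((m : ℤ) + 1) ^ (m + 1) - 2 ^ (m + 1) * m ^ m) := by
    refine (h1.pow).sub_even (Even.mul_right ?_ _)
    exact (even_two).pow_of_ne_zero (by omega)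
  rw [he.neg_one_pow, one_mul] at h
  rw [← h] at h2
  exact (Int.odd_mul.1 h2).2

/-- With `m = 2 d + 1` and a power of 2 cancelled, divisibility would give `(1 + 2d)^(2d+1) - (1 +
d)^(2d+2) = 2 d^2 E`. For odd `d` the left side is odd; for even `d` its expansion modulo `d^3`
shows that it is `d^2` times an odd number. -/
theorem not_two_pow_dvd_derivRes_bonacci {m : ℕ} (hm : 2 ≤ m) (ho : Odd m) :
    ¬ (2 : ℤ) ^ m ∣ derivRes (bonacci m) := by
  rintro ⟨E, hE⟩
  have h := derivRes_bonacci_eq hm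
  obtain ⟨d, rfl⟩ := ho
  have hd : d ≠ 0 := by omega
  have hd' : (d : ℤ) ≠ 0 := by exact_mod_cast hd
  rw [hE, Odd.neg_one_pow ⟨d, rfl⟩] at h
  push_cast at h
  have h1 : (2 : ℤ) * d ^ 2 * E = (1 + 2 * d) ^ (2 * d + 1) - (1 + d) ^ (2 * d + 2) := by
    have h2 : ((2 : ℤ) * d + 1 + 1) ^ (2 * d + 1 + 1) = 2 ^ (2 * d + 2) * (1 + d) ^ (2 * d + 2) := by
      rw [← mul_pow]; ring
    rw [h2] at h
    refine mul_left_cancel₀ (pow_ne_zero (2 * d + 2) (two_ne_zero (α := ℤ))) ?_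
    rw [show (1 + 2 * (d : ℤ)) = 2 * d + 1 by ring]
    linear_combination h
  rcases Nat.even_or_odd d with he | ho
  · obtain ⟨q, hq⟩ := one_add_pow_eq (2 * d) (2 * d + 1)
    obtain ⟨q', hq'⟩ := one_add_pow_eq d (2 * d + 2)
    have c1 : (2 * d + 1).choose 2 = d * (2 * d + 1) := by
      rw [Nat.choose_two_right]
      exact Nat.div_eq_of_eq_mul_left two_pos (by simp; ring)
    have c2 : (2 * d + 2).choose 2 = (d + 1) * (2 * d + 1) := by
      rw [Nat.choose_two_right]
      exact Nat.div_eq_of_eq_mul_left two_pos (by simp; ring)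
    rw [hq, hq', c1, c2] at h1
    push_cast at h1
    have h3 : 2 * E = 1 + d * (8 * d + 4 + 8 * q - 2 * d - 3 - q') := by
      refine mul_left_cancel₀ (pow_ne_zero 2 hd') ?_
      linear_combination h1
    have h4 : Even (d : ℤ) := by exact_mod_cast he
    have h5 : Even (2 * E) := even_two_mul E
    rw [h3, Int.even_add] at h5
    exact absurd (h5.2 (h4.mul_right _)) (by decide)
  · have h4 : Odd (d : ℤ) := by exact_mod_cast ho
    have h5 : Even (2 * (d : ℤ) ^ 2 * E) := ⟨d ^ 2 * E, by ring⟩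
    rw [h1, Int.even_sub] at h5
    have h6 : Even ((1 + (d : ℤ)) ^ (2 * d + 2)) :=
      (Odd.add_odd odd_one h4).pow_of_ne_zero (by omega)
    have h7 : Odd ((1 + 2 * (d : ℤ)) ^ (2 * d + 1)) := Odd.pow ⟨d, by ring⟩
    exact Int.not_even_iff_odd.2 h7 (h5.2 h6)

theorem derivRes_bonacci_ne_zero {m : ℕ} (hm : 2 ≤ m) : derivRes (bonacci m) ≠ 0 := by
  rcases Nat.even_or_odd m with h | h
  · intro h0
    simpa [h0] using odd_derivRes_bonacci hm h
  · intro h0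
    exact not_two_pow_dvd_derivRes_bonacci hm h (h0 ▸ dvd_zero _)

/-! ### Parity of the discriminant valuation and inertia. -/

/-- Here `δ` is a Vandermonde product: adjoining a root `a` to those of `q` multiplies the left side
by `± q(a)^2`. -/
theorem exists_prod_derivative_eq_sq {R : Type*} [CommRing R] (s : Multiset R) :
    ∃ (δ : R) (k : ℕ), (s.map (derivative (s.map fun r => X - C r).prod).eval).prod =
      (-1) ^ k * δ ^ 2 := by
  induction s using Multiset.induction with
  | empty => exact ⟨1, 0, by simp⟩
  | cons a s ih =>
    obtain ⟨δ, k, h⟩ := ih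
    set q := (s.map fun r => X - C r).prod with hq
    have hqr : ∀ x, q.eval x = (s.map fun r => x - r).prod := eval_prod_X_sub_C s
    refine ⟨q.eval a * δ, k + s.card, ?_⟩
    have h1 : ((s.map fun r => X - C r).prod.eval a) = (-1) ^ s.card * (s.map fun r => r - a).prod := by
      rw [← hq, hqr, ← Multiset.prod_replicate, ← Multiset.map_const', ← Multiset.prod_map_mul]
      simp
    have h1' : (s.map fun r => r - a).prod = (-1) ^ s.card * q.eval a := by
      rw [← hq] at h1
      rw [h1, ← mul_assoc, ← mul_pow]
      simp
    have h2 : (s.map (derivative ((X - C a) * q)).eval).prod =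
        (s.map fun r => r - a).prod * (s.map (derivative q).eval).prod := by
      rw [← Multiset.prod_map_mul]
      refine congrArg Multiset.prod (Multiset.map_congr rfl fun r hr => ?_)
      have h0 : q.eval r = 0 := by
        rw [hqr]
        exact Multiset.prod_eq_zero (Multiset.mem_map.2 ⟨r, hr, sub_self r⟩)
      simp [derivative_mul, h0]
    rw [Multiset.map_cons, Multiset.prod_cons, Multiset.map_cons, Multiset.prod_cons, ← hq, h2, h1', h]
    simp only [derivative_mul, derivative_sub, derivative_X, derivative_C, sub_zero, one_mul,
      eval_add, eval_mul, eval_sub, eval_X, eval_C, sub_self, zero_mul, add_zero]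
    ring

theorem algebraMap_derivRes {A B : Type*} [CommRing A] [CommRing B] [IsDomain B] [Algebra A B]
    {f : A[X]} (hf : f.Monic) (hs : (f.map (algebraMap A B)).Splits) :
    algebraMap A B (derivRes f) = ((f.map (algebraMap A B)).roots.map
      (derivative ((f.map (algebraMap A B)).roots.map fun r => X - C r).prod).eval).prod := by
  rw [← derivRes_map _ hf, derivRes_eq_prod (hf.map _) hs, ← hs.eq_prod_roots_of_monic (hf.map _)]

theorem nodup_roots_of_derivRes_ne_zero {A B : Type*} [CommRing A] [CommRing B] [IsDomain B]
    [Algebra A B] {f : A[X]} (hf : f.Monic) (hs : (f.map (algebraMap A B)).Splits)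
    (h0 : algebraMap A B (derivRes f) ≠ 0) : (f.map (algebraMap A B)).roots.Nodup := by
  classical
  rw [Multiset.nodup_iff_count_le_one]
  intro r
  by_contra hc
  have hr : r ∈ (f.map (algebraMap A B)).roots := Multiset.count_pos.1 (by omega)
  apply h0
  rw [algebraMap_derivRes hf hs]
  refine Multiset.prod_eq_zero (Multiset.mem_map.2 ⟨r, hr, ?_⟩)
  rw [eval_multiset_prod_X_sub_C_derivative hr]
  refine Multiset.prod_eq_zero (Multiset.mem_map.2 ⟨r, ?_, sub_self r⟩)
  rw [← Multiset.count_pos, Multiset.count_erase_self]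
  omega

/-- The set `s` has at most one pair of distinct elements that are congruent modulo `P`. -/
def AtMostOneCollision {B : Type*} [CommRing B] (P : Ideal B) (s : Set B) : Prop :=
  ∀ a ∈ s, ∀ b ∈ s, ∀ c ∈ s, ∀ d ∈ s, a - b ∈ P → c - d ∈ P → a ≠ b → c ≠ d →
    ({a, b} : Set B) = {c, d}

/-- If only `x` and `y` collide, the discriminant is `(x - y)^2 w` with `w` outside `P`. When its
valuation is even, `u = (x - y) w / π^a` lies in `B` and outside `P`. The swap sends `u` to `-u`,
whereas inertia fixes it modulo `P`, so `2 u ∈ P`, a contradiction. -/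
theorem swap_notMem_inertia {A B G : Type*} [CommRing A] [CommRing B] [IsDomain B]
    [IsIntegrallyClosed B] [Algebra A B] [Group G] [MulSemiringAction G B] [SMulCommClass G A B]
    {f : A[X]} (hf : f.Monic) (hs : (f.map (algebraMap A B)).Splits) (P : Ideal B) [hP : P.IsPrime]
    (h2 : (2 : B) ∉ P) (hcol : AtMostOneCollision P (f.rootSet B)) {π s : A} {a : ℕ}
    (hR : derivRes f = π ^ (2 * a) * s) (hsP : algebraMap A B s ∉ P)
    (hπ : algebraMap A B π ≠ 0) {g : G} (hg : g ∈ P.inertia G) {x y : B} (hx : x ∈ f.rootSet B)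
    (hy : y ∈ f.rootSet B) (hxy : x ≠ y) (hgx : g • x = y) (hgy : g • y = x) : False := by
  classical
  have hs0 : algebraMap A B s ≠ 0 := fun h => hsP (h ▸ P.zero_mem)
  have hR0 : algebraMap A B (derivRes f) ≠ 0 := by
    rw [hR, map_mul, map_pow]
    exact mul_ne_zero (pow_ne_zero _ hπ) hs0
  have hnd := nodup_roots_of_derivRes_ne_zero hf hs hR0
  have hroot : ∀ z, z ∈ f.rootSet B ↔ z ∈ (f.map (algebraMap A B)).roots := fun z => by
    rw [rootSet_def, Finset.mem_coe, Multiset.mem_toFinset, aroots_def]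
  have hprod := algebraMap_derivRes hf hs
  have hx' := (hroot x).1 hx
  have hy' := (hroot y).1 hy
  set S := (f.map (algebraMap A B)).roots with hS
  obtain ⟨t₀, ht₀⟩ := Multiset.exists_cons_of_mem hx'
  have hyt : y ∈ t₀ := by
    rw [ht₀, Multiset.mem_cons] at hy'
    exact hy'.resolve_left hxy.symm
  obtain ⟨t, ht⟩ := Multiset.exists_cons_of_mem hyt
  have hSt : S = x ::ₘ y ::ₘ t := by rw [ht₀, ht]
  have hnd' := hnd
  rw [hSt, Multiset.nodup_cons, Multiset.nodup_cons, Multiset.mem_cons] at hnd'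
  push Not at hnd'
  obtain ⟨⟨-, hxt⟩, hyt, -⟩ := hnd'
  have htS : ∀ {c}, c ∈ t → c ∈ S := fun hc => by
    rw [hSt]; exact Multiset.mem_cons_of_mem (Multiset.mem_cons_of_mem hc)
  have hxyP : x - y ∈ P := by
    have := hg y
    rwa [hgy] at this
  have hsep : ∀ {c d}, c ∈ S → d ∈ S → c ≠ d → (c ∈ t ∨ d ∈ t) → c - d ∉ P := by
    intro c d hc hd hcd hcdt hmem
    have h := hcol x hx y hy c ((hroot c).2 hc) d ((hroot d).2 hd) hxyP hmem hxy hcd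
    have hc' : c ∈ ({x, y} : Set B) := h ▸ Set.mem_insert _ _
    have hd' : d ∈ ({x, y} : Set B) := h ▸ Set.mem_insert_of_mem _ rfl
    rcases hcdt with hct | hct
    · rcases hc' with rfl | rfl
      · exact hxt hct
      · exact hyt hct
    · rcases hd' with rfl | rfl
      · exact hxt hct
      · exact hyt hct
  have hpn : ∀ {r} {u : Multiset B}, (∀ c ∈ u, r - c ∉ P) → (u.map fun c => r - c).prod ∉ P := by
    intro r u h hmem
    rw [hP.multiset_prod_mem_iff_exists_mem] at hmem
    obtain ⟨z, hz, hc'⟩ := hmem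
    obtain ⟨c, hc, rfl⟩ := Multiset.mem_map.1 hz
    exact h c hc hc'
  set D := derivative (S.map fun r => X - C r).prod with hD
  set w := -((t.map fun c => x - c).prod * (t.map fun c => y - c).prod * (t.map D.eval).prod) with hw
  have hDx : D.eval x = (x - y) * (t.map fun c => x - c).prod := by
    rw [hD, eval_multiset_prod_X_sub_C_derivative hx', hSt, Multiset.erase_cons_head,
      Multiset.map_cons, Multiset.prod_cons]
  have hDy : D.eval y = (y - x) * (t.map fun c => y - c).prod := by
    rw [hD, eval_multiset_prod_X_sub_C_derivative hy', hSt, Multiset.cons_swap,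
      Multiset.erase_cons_head, Multiset.map_cons, Multiset.prod_cons]
  have hRw : algebraMap A B (derivRes f) = (x - y) ^ 2 * w := by
    rw [hprod]
    conv_lhs => rw [hSt, Multiset.map_cons, Multiset.prod_cons, Multiset.map_cons,
      Multiset.prod_cons]
    rw [hDx, hDy, hw]
    ring
  have hwP : w ∉ P := by
    rw [hw, P.neg_mem_iff]
    refine hP.mul_notMem (hP.mul_notMem (hpn fun c hc => ?_) (hpn fun c hc => ?_)) fun hmem => ?_
    · exact hsep hx' (htS hc) (fun h => hxt (h ▸ hc)) (Or.inr hc)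
    · exact hsep hy' (htS hc) (fun h => hyt (h ▸ hc)) (Or.inr hc)
    · rw [hP.multiset_prod_mem_iff_exists_mem] at hmem
      obtain ⟨z, hz, hc'⟩ := hmem
      obtain ⟨c, hc, rfl⟩ := Multiset.mem_map.1 hz
      rw [hD, eval_multiset_prod_X_sub_C_derivative (htS hc)] at hc'
      exact hpn (fun d hd => hsep (htS hc) (Multiset.mem_of_mem_erase hd)
        (fun h => hnd.notMem_erase (h ▸ hd)) (Or.inl hc)) hc'
  have hsq : ((x - y) * w) ^ 2 = (algebraMap A B π ^ a) ^ 2 * (algebraMap A B s * w) := by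
    have h1 : (x - y) ^ 2 * w = algebraMap A B π ^ (2 * a) * algebraMap A B s := by
      rw [← hRw, hR, map_mul, map_pow]
    calc ((x - y) * w) ^ 2 = (x - y) ^ 2 * w * w := by ring
      _ = _ := by rw [h1]; ring
  -- Integral closedness extracts the square root of the divisibility `hsq`.
  obtain ⟨u, hu⟩ := (IsIntegrallyClosed.pow_dvd_pow_iff two_ne_zero).1 ⟨_, hsq⟩
  have hπa : algebraMap A B π ^ a ≠ 0 := pow_ne_zero _ hπ
  have hu2 : u ^ 2 = algebraMap A B s * w := by
    refine mul_left_cancel₀ (pow_ne_zero 2 hπa) ?_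
    rw [← hsq, hu, mul_pow]
  have huP : u ∉ P := fun h => hP.mul_notMem hsP hwP (hu2 ▸ P.pow_mem_of_mem h 2 two_pos)
  have hgw : g • w = w := by
    have h1 := congrArg (g • ·) hRw
    simp only [smul_algebraMap, smul_mul', smul_pow', smul_sub, hgx, hgy] at h1
    rw [hRw] at h1
    refine mul_left_cancel₀ (pow_ne_zero 2 (sub_ne_zero.2 hxy)) ?_
    rw [h1]
    ring
  have hgu : g • u = -u := by
    have h1 := congrArg (g • ·) hu
    simp only [smul_algebraMap, smul_mul', smul_pow', smul_sub, hgx, hgy, hgw] at h1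
    refine mul_left_cancel₀ hπa ?_
    rw [← h1]
    linear_combination -hu
  have h4 := hg u
  rw [hgu] at h4
  have h5 : (2 : B) * u ∈ P := by
    have := P.neg_mem h4
    rwa [show -(-u - u) = 2 * u by ring] at this
  exact hP.mul_notMem h2 huP h5

open scoped Pointwise in
/-- The inertia group at a prime at which the discriminant has odd valuation is not trivial. -/
theorem exists_inertia_ne_one {A B G : Type*} [CommRing A] [IsDomain A] [CommRing B]
    [IsDedekindDomain B] [Algebra A B] [Module.Finite A B] [Module.Flat A B] [FaithfulSMul A B]
    [Group G] [Finite G] [MulSemiringAction G B] [IsGaloisGroup G A B]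
    {f : A[X]} (hf : f.Monic) (hs : (f.map (algebraMap A B)).Splits) {π s : A} (hπ : Prime π)
    {a : ℕ} (hR : derivRes f = π ^ (2 * a + 1) * s) (hsπ : ¬ π ∣ s) (p : Ideal A) [p.IsPrime]
    (hp : p = Ideal.span {π}) [PerfectField p.ResidueField] (P : Ideal B) [hP : P.IsPrime]
    [P.LiesOver p] : ∃ g ∈ P.inertia G, g ≠ 1 := by
  by_contra! hc
  have hI : P.inertia G = ⊥ := (Subgroup.eq_bot_iff_forall _).2 hc
  have hcard := Ideal.card_inertia_eq_ramificationIdxIn (G := G) p P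
  rw [hI, Subgroup.card_bot, Ideal.ramificationIdxIn_eq_ramificationIdx p P G] at hcard
  have hinj := FaithfulSMul.algebraMap_injective A B
  have hmap : p.map (algebraMap A B) = Ideal.span {algebraMap A B π} := by
    rw [hp, Ideal.map_span, Set.image_singleton]
  have hπ0 : algebraMap A B π ≠ 0 := fun h => hπ.ne_zero (hinj (h.trans (map_zero _).symm))
  have hne : p.map (algebraMap A B) ≠ ⊥ := by
    rw [hmap, Ne, Ideal.span_singleton_eq_bot]
    exact hπ0
  have hPne : P ≠ ⊥ := ne_bot_of_le_ne_bot hne (Ideal.map_le_of_le_comap (P.over_def p).le)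
  have hPp : Prime P := Ideal.prime_of_isPrime hPne hP
  rw [Ideal.IsDedekindDomain.ramificationIdx_eq_multiplicity p P hne, hmap] at hcard
  have hfin : ∀ {x : B}, x ≠ 0 → FiniteMultiplicity P (Ideal.span {x}) := fun hx =>
    FiniteMultiplicity.of_prime_left hPp (by rwa [Ne, Ideal.zero_eq_bot, Ideal.span_singleton_eq_bot])
  have hsP : algebraMap A B s ∉ P := by
    intro h
    have h1 : s ∈ P.under A := h
    rw [← P.over_def p, hp, Ideal.mem_span_singleton] at h1
    exact hsπ h1
  have hs0 : algebraMap A B s ≠ 0 := fun h => hsP (h ▸ P.zero_mem)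
  -- Up to sign the discriminant is the square `δ^2` in `B`, so its valuation at `P` is even;
  -- trivial inertia means ramification index 1, which makes that valuation `2 * a + 1`.
  obtain ⟨δ, k, hδ⟩ := exists_prod_derivative_eq_sq (f.map (algebraMap A B)).roots
  rw [← algebraMap_derivRes hf hs, hR, map_mul, map_pow] at hδ
  have hδ0 : δ ≠ 0 := by
    rintro rfl
    rw [zero_pow two_ne_zero, mul_zero] at hδ
    exact mul_ne_zero (pow_ne_zero _ hπ0) hs0 hδ
  have hspan : Ideal.span {algebraMap A B π} ^ (2 * a + 1) * Ideal.span {algebraMap A B s} =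
      Ideal.span {δ} ^ 2 := by
    rw [Ideal.span_singleton_pow, Ideal.span_singleton_mul_span_singleton, hδ,
      Ideal.span_singleton_pow]
    exact Ideal.span_singleton_mul_left_unit (IsUnit.pow _ isUnit_one.neg) _
  have hm := congrArg (emultiplicity P) hspan
  have hs1 : emultiplicity P (Ideal.span {algebraMap A B s}) = 0 := by
    rw [emultiplicity_eq_zero, Ideal.dvd_span_singleton]
    exact hsP
  rw [emultiplicity_mul hPp, emultiplicity_pow hPp, emultiplicity_pow hPp, hs1,
    (hfin hπ0).emultiplicity_eq_multiplicity, (hfin hδ0).emultiplicity_eq_multiplicity,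
    ← hcard] at hm
  have hm' : 2 * a + 1 = 2 * multiplicity P (Ideal.span {δ}) := by
    have h : ((2 * a + 1 : ℕ) : ℕ∞) = ((2 * multiplicity P (Ideal.span {δ}) : ℕ) : ℕ∞) := by
      simpa using hm
    exact_mod_cast h
  omega

/-! ### Transport of Galois actions between root sets. -/

section Equivariant

variable {G X Y : Type*} [Group G] [MulAction G X] [MulAction G Y]

theorem toPermHom_eq_permCongr (e : X ≃ Y) (he : ∀ (g : G) x, e (g • x) = g • e x) (g : G) :
    MulAction.toPermHom G Y g = e.permCongr (MulAction.toPermHom G X g) := by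
  ext y
  simp [Equiv.permCongr_apply, he]

theorem Equiv.Perm.IsSwap.permCongr [DecidableEq X] [DecidableEq Y] (e : X ≃ Y)
    {σ : Equiv.Perm X} (h : σ.IsSwap) : (e.permCongr σ).IsSwap := by
  obtain ⟨x, y, hxy, rfl⟩ := h
  refine ⟨e x, e y, e.injective.ne hxy, ?_⟩
  ext z
  simp [Equiv.permCongr_apply, Equiv.swap_apply_def, Equiv.symm_apply_eq, apply_ite e]

theorem isSwap_toPermHom_of_equiv [DecidableEq X] [DecidableEq Y] (e : X ≃ Y)
    (he : ∀ (g : G) x, e (g • x) = g • e x) {g : G} (h : (MulAction.toPermHom G X g).IsSwap) :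
    (MulAction.toPermHom G Y g).IsSwap :=
  toPermHom_eq_permCongr e he g ▸ h.permCongr e

theorem surjective_toPermHom_of_equiv (e : X ≃ Y) (he : ∀ (g : G) x, e (g • x) = g • e x)
    (h : Function.Surjective (MulAction.toPermHom G X)) :
    Function.Surjective (MulAction.toPermHom G Y) := by
  intro σ
  obtain ⟨g, hg⟩ := h (e.symm.permCongr σ)
  refine ⟨g, ?_⟩
  rw [toPermHom_eq_permCongr e he, hg]
  ext y
  simp [Equiv.permCongr_apply]

end Equivariant

section AKLB

variable {A : Type*} (K L B : Type*) [CommRing A] [Field K] [Field L] [CommRing B] [Algebra A B]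
  [Algebra A K] [Algebra B L] [Algebra K L] [Algebra A L]
  [IsScalarTower A B L] [IsScalarTower A K L] [IsIntegralClosure B A L]

theorem mem_rootSet_iff_of_monic {A S : Type*} [CommRing A] [CommRing S] [IsDomain S] [Algebra A S]
    {f : A[X]} (hf : f.Monic) {x : S} : x ∈ f.rootSet S ↔ aeval x f = 0 := by
  rw [mem_rootSet', and_iff_right (hf.map _).ne_zero]

theorem mem_rootSet_map_iff {f : A[X]} (hf : f.Monic) {x : L} :
    x ∈ (f.map (algebraMap A K)).rootSet L ↔ aeval x f = 0 := by
  rw [mem_rootSet_iff_of_monic (hf.map _), aeval_map_algebraMap]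

/-- The roots of a monic polynomial in the integral closure of the base ring are its roots in the
field. -/
def rootSetEquiv [IsDomain B] {f : A[X]} (hf : f.Monic) :
    f.rootSet B ≃ (f.map (algebraMap A K)).rootSet L :=
  Equiv.ofBijective (fun x => ⟨algebraMap B L x.1, by
    rw [mem_rootSet_map_iff K L hf, aeval_algebraMap_apply, (mem_rootSet_iff_of_monic hf).1 x.2,
      map_zero]⟩)
    ⟨fun x y h => Subtype.ext (IsIntegralClosure.algebraMap_injective B A L
      (congrArg Subtype.val h)), fun y => by
      have hy := (mem_rootSet_map_iff K L hf).1 y.2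
      have hint : IsIntegral A y.1 := ⟨f, hf, hy⟩
      obtain ⟨x, hx⟩ := (IsIntegralClosure.isIntegral_iff (A := B)).1 hint
      refine ⟨⟨x, ?_⟩, Subtype.ext hx⟩
      rw [mem_rootSet_iff_of_monic hf]
      apply IsIntegralClosure.algebraMap_injective B A L
      rw [← aeval_algebraMap_apply, hx, hy, map_zero]⟩

theorem splits_integralClosure [IsDomain B] {f : A[X]} (hf : f.Monic)
    (hs : ((f.map (algebraMap A K)).map (algebraMap K L)).Splits) :
    (f.map (algebraMap A B)).Splits := by
  rw [Polynomial.map_map, ← IsScalarTower.algebraMap_eq A K L, IsScalarTower.algebraMap_eq A B L,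
    ← Polynomial.map_map] at hs
  refine hs.of_splits_map_of_injective (IsIntegralClosure.algebraMap_injective B A L) fun a ha => ?_
  have h := isRoot_of_mem_roots ha
  rw [Polynomial.map_map, ← IsScalarTower.algebraMap_eq A B L, IsRoot.def, eval_map_algebraMap] at h
  exact (IsIntegralClosure.isIntegral_iff (A := B)).1 ⟨f, hf, h⟩

theorem faithful_rootSet {K L : Type*} [Field K] [Field L] [Algebra K L] {F : K[X]}
    [IsSplittingField K L F] {g : Gal(L/K)} (h : MulAction.toPermHom Gal(L/K) (F.rootSet L) g = 1) :
    g = 1 := by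
  have h1 : (g : L →ₐ[K] L) = AlgHom.id K L := by
    refine AlgHom.ext_of_adjoin_eq_top (IsSplittingField.adjoin_rootSet L F) fun x hx => ?_
    exact congrArg Subtype.val (Equiv.congr_fun h ⟨x, hx⟩)
  ext x
  exact DFunLike.congr_fun h1 x

theorem rootSetEquiv_smul [IsDomain B] {G : Type*} [Group G] [MulSemiringAction G B]
    [MulSemiringAction G L] [SMulCommClass G A B] [SMulCommClass G K L] [SMulDistribClass G B L]
    {f : A[X]} (hf : f.Monic) (g : G) (x : f.rootSet B) :
    rootSetEquiv K L B hf (g • x) = g • rootSetEquiv K L B hf x :=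
  Subtype.ext (algebraMap.coe_smul' g x.1 L)

variable [IsFractionRing A K] [IsDedekindDomain A] [FiniteDimensional K L] [IsGalois K L] [IsDedekindDomain B]
  [MulSemiringAction Gal(L/K) B] [SMulDistribClass Gal(L/K) B L]

open Classical in
/-- If a prime at which the discriminant has odd valuation allows at most one collision of roots,
then the Galois group contains a transposition. -/
theorem exists_isSwap_of_odd {f : A[X]} (hf : f.Monic)
    [IsSplittingField K L (f.map (algebraMap A K))] {π s : A} (hπ : Prime π)
    {a : ℕ} (hR : derivRes f = π ^ (2 * a + 1) * s) (hsπ : ¬ π ∣ s) (p : Ideal A) [p.IsPrime]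
    (hp : p = Ideal.span {π}) [PerfectField p.ResidueField]
    (hcol : ∀ (P : Ideal B) [P.IsPrime] [P.LiesOver p],
      (f.rootSet B).ncard ≤ (f.rootSet (B ⧸ P)).ncard + 1) :
    ∃ g : Gal(L/K), (MulAction.toPermHom Gal(L/K)
      ((f.map (algebraMap A K)).rootSet L) g).IsSwap := by
  have hfin : Module.Finite A B := IsIntegralClosure.finite A K L B
  have hfrac := IsIntegralClosure.isFractionRing_of_finite_extension A K L B
  have hint := IsIntegralClosure.isIntegral_algebra A (A := B) L
  have hG := IsGaloisGroup.of_isFractionRing Gal(L/K) A B K L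
  have := hG.commutes
  have hinj : FaithfulSMul A B := by
    rw [faithfulSMul_iff_algebraMap_injective]
    have h : Function.Injective (algebraMap A L) := by
      rw [IsScalarTower.algebraMap_eq A K L]
      exact (algebraMap K L).injective.comp (IsFractionRing.injective A K)
    rw [IsScalarTower.algebraMap_eq A B L] at h
    exact Function.Injective.of_comp h
  have htf : Module.IsTorsionFree A B := inferInstance
  have hs := splits_integralClosure K L B hf (IsSplittingField.splits L _)
  obtain ⟨P, hP, hlo⟩ : ∃ P : Ideal B, P.IsPrime ∧ P.LiesOver p := by
    obtain ⟨⟨P, h1, h2⟩⟩ := (inferInstance : Nonempty (Ideal.primesOver p B))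
    exact ⟨P, h1, h2⟩
  obtain ⟨g, hg, hg1⟩ := exists_inertia_ne_one (G := Gal(L/K)) hf hs hπ hR hsπ p hp P
  have hsm := rootSetEquiv_smul K L B (G := Gal(L/K)) hf
  refine ⟨g, isSwap_toPermHom_of_equiv (rootSetEquiv K L B hf) hsm ?_⟩
  -- With at most one collision modulo `P`, an inertia element fixes all roots or swaps the
  -- colliding pair; faithfulness on roots excludes the former for `g ≠ 1`.
  refine (hs.toPermHom_apply_eq_one_or_isSwap_of_ncard_le_of_mem_inertia P (hcol P) g hg
    ).resolve_left fun h => hg1 (faithful_rootSet (F := f.map (algebraMap A K)) ?_)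
  rw [toPermHom_eq_permCongr (rootSetEquiv K L B hf) hsm, h]
  ext
  simp [Equiv.permCongr_apply]

end AKLB

/-! ### Prime degree, and collisions modulo a maximal ideal. -/

/-- By transitivity the prime degree divides the order of the image, which therefore contains a full
cycle; with a transposition this generates everything. -/
theorem surjective_of_isSwap_of_prime {G X : Type*} [Group G] [Fintype X] [DecidableEq X]
    [MulAction G X] [MulAction.IsPretransitive G X] (hp : (Fintype.card X).Prime) {g : G}
    (hg : (MulAction.toPermHom G X g).IsSwap) :
    Function.Surjective (MulAction.toPermHom G X) := by
  classical
  rw [← MonoidHom.range_eq_top]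
  have : Nonempty X := Fintype.card_pos_iff.1 hp.pos
  let x : X := Classical.arbitrary X
  refine Equiv.Perm.subgroup_eq_top_of_swap_mem hp ?_ ⟨g, rfl⟩ hg
  have : MulAction.IsPretransitive (MulAction.toPermHom G X).range X := ⟨fun a b => by
    obtain ⟨g, hg⟩ := MulAction.exists_smul_eq G a b
    exact ⟨⟨_, g, rfl⟩, hg⟩⟩
  have h := MulAction.card_orbit_mul_card_stabilizer_eq_card_group (MulAction.toPermHom G X).range x
  rw [← h]
  refine Dvd.intro _ (congrArg (· * _) ?_)
  rw [Fintype.card_eq_nat_card, Fintype.card_eq_nat_card,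
    MulAction.orbit_eq_univ, Nat.card_congr (Equiv.Set.univ X)]

theorem ncard_rootSet_le_natDegree {R S : Type*} [CommRing R] [CommRing S] [IsDomain S]
    [Algebra R S] (f : R[X]) : (f.rootSet S).ncard ≤ f.natDegree := by
  classical
  rw [rootSet_def, Set.ncard_coe_finset]
  refine (Multiset.toFinset_card_le _).trans ((card_roots' _).trans ?_)
  exact natDegree_map_le

theorem le_ncard_rootSet_bonacci {κ : Type*} [Field κ] {m : ℕ} (hm : 1 ≤ m)
    (h2 : (2 : κ) ≠ 0 ∨ Even m) (hs : ((bonacci m).map (algebraMap ℤ κ)).Splits) :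
    m ≤ ((bonacci m).rootSet κ).ncard + 1 := by
  classical
  have hmon := bonacci_monic hm
  rw [rootSet_def, Set.ncard_coe_finset, aroots_def]
  have h := card_le_card_toFinset_add_one_of_bonacci' hm h2
    (hs.eq_prod_roots_of_monic (hmon.map _))
  rwa [← hs.natDegree_eq_card_roots, hmon.natDegree_map, bonacci_natDegree hm] at h

theorem bonacci_collision {B : Type*} [CommRing B] [IsDomain B] {m : ℕ} (hm : 1 ≤ m)
    (hs : ((bonacci m).map (algebraMap ℤ B)).Splits) (P : Ideal B) [P.IsMaximal]
    (h2 : (2 : B) ∉ P ∨ Even m) :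
    ((bonacci m).rootSet B).ncard ≤ ((bonacci m).rootSet (B ⧸ P)).ncard + 1 := by
  let := Ideal.Quotient.field P
  have hs' : ((bonacci m).map (algebraMap ℤ (B ⧸ P))).Splits := by
    have h := hs.map (Ideal.Quotient.mk P)
    rwa [Polynomial.map_map, show (Ideal.Quotient.mk P).comp (algebraMap ℤ B) =
      algebraMap ℤ (B ⧸ P) from RingHom.ext_int _ _] at h
  refine ((ncard_rootSet_le_natDegree _).trans_eq (bonacci_natDegree hm)).trans
    (le_ncard_rootSet_bonacci hm (h2.imp_left fun h h0 => h ?_) hs')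
  rw [← Ideal.Quotient.eq_zero_iff_mem]
  exact_mod_cast h0

theorem perfectField_residueField {R : Type*} [CommRing R] (p : Ideal R) [p.IsMaximal]
    [Finite (R ⧸ p)] : PerfectField p.ResidueField := by
  have : Finite p.ResidueField :=
    Finite.of_surjective _ (Ideal.bijective_algebraMap_quotient_residueField p).2
  infer_instance

theorem atMostOneCollision_of_ncard_le {A B : Type*} [CommRing A] [CommRing B] [IsDomain B]
    [Algebra A B] {f : A[X]} (hf : f.Monic) (hs : (f.map (algebraMap A B)).Splits) (P : Ideal B)
    [P.IsPrime] (h : (f.rootSet B).ncard ≤ (f.rootSet (B ⧸ P)).ncard + 1) :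
    AtMostOneCollision P (f.rootSet B) := by
  have himg := hs.image_rootSet_of_map_ne_zero (Ideal.Quotient.mkₐ A P) (hf.map _).ne_zero
  rw [← himg, Set.ncard_le_ncard_image_add_one_iff] at h
  intro a ha b hb c hc d hd hab hcd
  exact h a ha b hb c hc d hd (Ideal.Quotient.eq.2 hab) (Ideal.Quotient.eq.2 hcd)

/-! ### Inertia groups over the rationals. -/

section NumberField

open NumberField

variable (L : Type*) [Field L] [NumberField L]

open scoped Pointwise in
/-- The Galois group of a number field over `ℚ` is generated by its inertia groups. -/
theorem iSup_inertia_eq_top [IsGalois ℚ L] :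
    ⨆ M : MaximalSpectrum (𝓞 L), M.asIdeal.inertia Gal(L/ℚ) = ⊤ := by
  set H := ⨆ M : MaximalSpectrum (𝓞 L), M.asIdeal.inertia Gal(L/ℚ) with hH
  set E := IntermediateField.fixedField H with hE
  suffices h : Module.finrank ℚ E = 1 by
    have h1 := IntermediateField.finrank_eq_one_iff.1 h
    rw [← IntermediateField.fixingSubgroup_fixedField H, ← hE, h1, IntermediateField.fixingSubgroup_bot]
  by_contra hne
  -- By Minkowski, a fixed field larger than `ℚ` has a ramified prime.
  obtain ⟨Q, hQ, hram⟩ := NumberField.exists_not_isUnramifiedAt_int (K := E) (𝒪 := 𝓞 E) hne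
  have hGal : IsGaloisGroup H E L := IsGaloisGroup.of_fixedPoints_eq Gal(L/ℚ) ℚ L H E rfl
  have : IsGaloisGroup H (𝓞 E) (𝓞 L) := IsGaloisGroup.of_isFractionRing H (𝓞 E) (𝓞 L) E L
  obtain ⟨P, hP, hPQ⟩ : ∃ P : Ideal (𝓞 L), P.IsPrime ∧ P.LiesOver Q := by
    obtain ⟨⟨P, h1, h2⟩⟩ := (inferInstance : Nonempty (Ideal.primesOver Q (𝓞 L)))
    exact ⟨P, h1, h2⟩
  have hQ0 : Q ≠ ⊥ := Ideal.IsMaximal.ne_bot_of_isIntegral_int Q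
  have hPm : P.IsMaximal := hP.isMaximal (Ideal.ne_bot_of_liesOver_of_ne_bot hQ0 P)
  set p := P.under ℤ with hp
  have hpm : p.IsMaximal := Ideal.isMaximal_comap_of_isIntegral_of_isMaximal P
  have hp0 : p ≠ ⊥ := Ideal.IsMaximal.ne_bot_of_isIntegral_int p
  have : Finite (ℤ ⧸ p) := Ideal.finiteQuotientOfFreeOfNeBot p hp0
  have : Finite (𝓞 E ⧸ Q) := Ideal.finiteQuotientOfFreeOfNeBot Q hQ0
  have := perfectField_residueField p
  have := perfectField_residueField Q
  have hPp : P.LiesOver p := ⟨rfl⟩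
  have h1 := Ideal.card_inertia_eq_ramificationIdxIn (G := Gal(L/ℚ)) p P
  have h2 := Ideal.card_inertia_eq_ramificationIdxIn (G := H) Q P
  rw [Ideal.ramificationIdxIn_eq_ramificationIdx p P Gal(L/ℚ)] at h1
  rw [Ideal.ramificationIdxIn_eq_ramificationIdx Q P H] at h2
  -- As `H` contains the whole inertia group of `P`, ramification over `E` equals ramification over
  -- `ℚ`, and multiplicativity leaves index 1 for `Q`.
  have hle : P.inertia Gal(L/ℚ) ≤ H := le_iSup
    (fun M : MaximalSpectrum (𝓞 L) => M.asIdeal.inertia Gal(L/ℚ)) ⟨P, hPm⟩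
  have h3 : Nat.card (P.inertia H) = Nat.card (P.inertia Gal(L/ℚ)) := by
    rw [← Nat.card_congr (Subgroup.subgroupOfEquivOfLe hle).toEquiv]
    rfl
  have h4 := Ideal.ramificationIdx_tower (R := ℤ) Q P
  rw [← h1, ← h2, h3] at h4
  have h5 : 0 < Nat.card (P.inertia Gal(L/ℚ)) := Nat.card_pos
  have h6 : Q.ramificationIdx ℤ = 1 := by
    have := Nat.eq_of_mul_eq_mul_right h5 ((one_mul _).trans h4)
    exact this.symm
  exact hram (Ideal.ramificationIdx_eq_one_iff.1 h6)

variable {L} {m : ℕ} [IsSplittingField ℚ L ((bonacci m).map (algebraMap ℤ ℚ))]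

theorem bonacci_splits_ringOfIntegers (hm : 1 ≤ m) :
    ((bonacci m).map (algebraMap ℤ (𝓞 L))).Splits :=
  splits_integralClosure ℚ L (𝓞 L) (bonacci_monic hm) (IsSplittingField.splits L _)

theorem bonacci_irreducible_rat (hm : 2 ≤ m) :
    Irreducible ((bonacci m).map (algebraMap ℤ ℚ)) :=
  ((bonacci_monic (by omega)).irreducible_iff_irreducible_map_fraction_map).1
    (bonacci_irreducible hm)

theorem isPretransitive_rootSet {K L : Type*} [Field K] [Field L] [Algebra K L] [Normal K L]
    {F : K[X]} (hF : Irreducible F) : MulAction.IsPretransitive Gal(L/K) (F.rootSet L) := by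
  refine ⟨fun x y => ?_⟩
  have hx : minpoly K (x : L) = minpoly K (y : L) := by
    have h1 := minpoly.eq_of_irreducible hF (mem_rootSet.1 x.2).2
    have h2 := minpoly.eq_of_irreducible hF (mem_rootSet.1 y.2).2
    rw [← h1, ← h2]
  obtain ⟨g, hg⟩ := (Normal.minpoly_eq_iff_mem_orbit L).1 hx.symm
  exact ⟨g, Subtype.ext hg⟩

/-- For even `m` the Galois group of `x^m + ⋯ + x - 1` is the full symmetric group. -/
theorem bonacci_surjective_of_even [IsGalois ℚ L] (hm : 2 ≤ m) (he : Even m) :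
    Function.Surjective (MulAction.toPermHom Gal(L/ℚ)
      (((bonacci m).map (algebraMap ℤ ℚ)).rootSet L)) := by
  have hmon := bonacci_monic (m := m) (by omega)
  have hsm := rootSetEquiv_smul ℚ L (𝓞 L) (G := Gal(L/ℚ)) hmon
  have hs := bonacci_splits_ringOfIntegers (L := L) (m := m) (by omega)
  have htr := isPretransitive_rootSet (L := L) (bonacci_irreducible_rat hm)
  have htr' : MulAction.IsPretransitive Gal(L/ℚ) ((bonacci m).rootSet (𝓞 L)) := ⟨fun x y => by
    obtain ⟨g, hg⟩ := MulAction.exists_smul_eq Gal(L/ℚ) (rootSetEquiv ℚ L (𝓞 L) hmon x)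
      (rootSetEquiv ℚ L (𝓞 L) hmon y)
    rw [← hsm] at hg
    exact ⟨g, (rootSetEquiv ℚ L (𝓞 L) hmon).injective hg⟩⟩
  refine surjective_toPermHom_of_equiv (rootSetEquiv ℚ L (𝓞 L) hmon) hsm ?_
  refine hs.surjective_toPermHom_of_iSup_inertia_eq_top (fun M => ?_) (iSup_inertia_eq_top L)
  have := M.isMaximal
  -- Evenness of `m` is what makes the collision bound hold at primes above 2 as well.
  exact bonacci_collision (by omega) hs M.asIdeal (Or.inr he)

-- Here "even" refers to the valuation of the discriminant at `p`, not to `m`. The collision bound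
-- leaves only the identity and transpositions, and `swap_notMem_inertia` excludes the latter.
open Classical in
theorem inertia_eq_one_of_even (hm : 2 ≤ m) {p : ℤ} (hp : Prime p) (hp2 : ¬ p ∣ 2) {a : ℕ} {s : ℤ}
    (hR : derivRes (bonacci m) = p ^ (2 * a) * s) (hsp : ¬ p ∣ s) (P : Ideal (𝓞 L)) [P.IsMaximal]
    [P.LiesOver (Ideal.span {p})] {g : Gal(L/ℚ)} (hg : g ∈ P.inertia Gal(L/ℚ)) : g = 1 := by
  have hmon := bonacci_monic (m := m) (by omega)
  have hsm := rootSetEquiv_smul ℚ L (𝓞 L) (G := Gal(L/ℚ)) hmon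
  have hs := bonacci_splits_ringOfIntegers (L := L) (m := m) (by omega)
  have hmem : ∀ z : ℤ, ¬ p ∣ z → algebraMap ℤ (𝓞 L) z ∉ P := by
    intro z hz h
    have h1 : z ∈ P.under ℤ := h
    rw [← P.over_def (Ideal.span {p}), Ideal.mem_span_singleton] at h1
    exact hz h1
  have h2 : (2 : 𝓞 L) ∉ P := by simpa using hmem 2 hp2
  have hcol := bonacci_collision (by omega) hs P (Or.inl h2)
  rcases hs.toPermHom_apply_eq_one_or_isSwap_of_ncard_le_of_mem_inertia P hcol g hg with h | h
  · refine faithful_rootSet (F := (bonacci m).map (algebraMap ℤ ℚ)) ?_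
    rw [toPermHom_eq_permCongr (rootSetEquiv ℚ L (𝓞 L) hmon) hsm, h]
    ext
    simp [Equiv.permCongr_apply]
  · exfalso
    obtain ⟨x, y, hxy, hsw⟩ := h
    refine swap_notMem_inertia hmon hs P h2 (atMostOneCollision_of_ncard_le hmon hs P hcol) hR
      (hmem s hsp) ?_ hg x.2 y.2 (fun h => hxy (Subtype.ext h)) ?_ ?_
    · rw [Ne, FaithfulSMul.algebraMap_eq_zero_iff]
      exact hp.ne_zero
    · have := Equiv.congr_fun hsw x
      rw [Equiv.swap_apply_left] at this
      exact congrArg Subtype.val this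
    · have := Equiv.congr_fun hsw y
      rw [Equiv.swap_apply_right] at this
      exact congrArg Subtype.val this

end NumberField

/-! ### An odd prime of odd valuation, from Minkowski's bound. -/

section Discriminant

open NumberField

/-- Embeddings of `K` into `ℂ` correspond to the complex roots of `f`, so both sides are the product
of `f'` over these roots. -/
theorem algebraMap_norm_aeval_derivative {K : Type*} [Field K] [NumberField K] {f : ℤ[X]}
    (hf : f.Monic) (hirr : Irreducible (f.map (algebraMap ℤ ℚ))) {x : K} (hx : aeval x f = 0)
    (htop : IntermediateField.adjoin ℚ {x} = ⊤) :
    Algebra.norm ℚ (aeval x (derivative f)) = algebraMap ℤ ℚ (derivRes f) := by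
  classical
  apply (algebraMap ℚ ℂ).injective
  rw [Algebra.norm_eq_prod_embeddings, ← IsScalarTower.algebraMap_apply ℤ ℚ ℂ,
    algebraMap_derivRes hf (IsAlgClosed.splits _),
    ← (IsAlgClosed.splits (f.map (algebraMap ℤ ℂ))).eq_prod_roots_of_monic (hf.map _)]
  have hmin : minpoly ℚ x = f.map (algebraMap ℤ ℚ) :=
    (minpoly.eq_of_irreducible_of_monic hirr (by rwa [aeval_map_algebraMap]) (hf.map _)).symm
  let pb := PowerBasis.ofAdjoinEqTop (Algebra.IsIntegral.isIntegral (R := ℚ) x)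
    (by rw [← IntermediateField.adjoin_simple_toSubalgebra_of_isAlgebraic
          (Algebra.IsAlgebraic.isAlgebraic x), htop, IntermediateField.top_toSubalgebra])
  have hgen : pb.gen = x := PowerBasis.ofAdjoinEqTop_gen _ _
  have hroots : (minpoly ℚ pb.gen).aroots ℂ = (f.map (algebraMap ℤ ℂ)).roots := by
    rw [hgen, hmin, aroots_def, Polynomial.map_map, ← IsScalarTower.algebraMap_eq]
  have hnd : ((minpoly ℚ pb.gen).aroots ℂ).Nodup :=
    nodup_roots ((minpoly.irreducible (Algebra.IsIntegral.isIntegral _)).separable.map)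
  rw [← hroots, ← Multiset.dedup_eq_self.2 hnd, ← Multiset.toFinset_val,
    ← Finset.prod_eq_multiset_prod]
  rw [Finset.prod_subtype (p := fun y => y ∈ (minpoly ℚ pb.gen).aroots ℂ) _ (by simp)]
  refine Fintype.prod_equiv (pb.liftEquiv' (B := ℂ)) _ _ fun σ => ?_
  have h : (pb.liftEquiv' (B := ℂ) σ : ℂ) = σ x := by
    rw [← hgen]
    simp [PowerBasis.liftEquiv']
  rw [h, derivative_map, eval_map_algebraMap]
  exact (aeval_algHom_apply (σ : K →+* ℂ).toIntAlgHom x (derivative f)).symm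

/-- The element `f'(x)` lies in the different ideal, whose norm is the absolute discriminant of `K`.
-/
theorem discr_dvd_derivRes {K : Type*} [Field K] [NumberField K] {f : ℤ[X]}
    (hf : f.Monic) (hirr : Irreducible (f.map (algebraMap ℤ ℚ))) {x : K} (hx : aeval x f = 0)
    (htop : IntermediateField.adjoin ℚ {x} = ⊤) : discr K ∣ derivRes f := by
  have hxi : IsIntegral ℤ x := ⟨f, hf, hx⟩
  let z : 𝓞 K := ⟨x, hxi⟩
  have hmin : minpoly ℤ z = f := by
    have h1 : minpoly ℤ z = minpoly ℤ x :=
      (minpoly.algebraMap_eq (RingOfIntegers.coe_injective) z).symm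
    rw [h1]
    apply map_injective (algebraMap ℤ ℚ) (algebraMap ℤ ℚ).injective_int
    rw [← minpoly.isIntegrallyClosed_eq_field_fractions' ℚ hxi]
    exact (minpoly.eq_of_irreducible_of_monic hirr (by rwa [aeval_map_algebraMap])
      (hf.map _)).symm
  have hmem := aeval_derivative_mem_differentIdeal ℤ ℚ K z (by
    rw [← IntermediateField.adjoin_simple_toSubalgebra_of_isAlgebraic
          (Algebra.IsAlgebraic.isAlgebraic _)]
    change (IntermediateField.adjoin ℚ {x}).toSubalgebra = _
    rw [htop, IntermediateField.top_toSubalgebra])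
  have hdvd := Ideal.absNorm_dvd_norm_of_mem hmem
  rw [hmin, absNorm_differentIdeal K, Int.natCast_natAbs, abs_dvd] at hdvd
  have hnorm : Algebra.norm ℤ (aeval z (derivative f)) = derivRes f := by
    apply (algebraMap ℤ ℚ).injective_int
    rw [← algebraMap_norm_aeval_derivative hf hirr hx htop, eq_intCast, Algebra.coe_norm_int]
    congr 1
    exact (aeval_algebraMap_apply K z _).symm
  rwa [hnorm] at hdvd

theorem not_dvd_discr_of_even {L : Type*} [Field L] [NumberField L] [IsGalois ℚ L] {m : ℕ}
    [IsSplittingField ℚ L ((bonacci m).map (algebraMap ℤ ℚ))] (hm : 2 ≤ m) {p : ℤ}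
    (hp : Prime p) (hp2 : ¬ p ∣ 2) {a : ℕ} {s : ℤ}
    (hR : derivRes (bonacci m) = p ^ (2 * a) * s) (hsp : ¬ p ∣ s) : ¬ p ∣ discr L := by
  rw [not_dvd_discr_iff_forall_liesOver L (𝓞 L) hp]
  intro P hP hlo
  have hp0 : Ideal.span {p} ≠ ⊥ := by simpa using hp.ne_zero
  have hpm : (Ideal.span {p}).IsMaximal :=
    ((Ideal.span_singleton_prime hp.ne_zero).2 hp).isMaximal hp0
  have : Finite (ℤ ⧸ Ideal.span {p}) := Ideal.finiteQuotientOfFreeOfNeBot _ hp0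
  have hperf := perfectField_residueField (Ideal.span {p})
  have h1 := Ideal.card_inertia_eq_ramificationIdxIn (G := Gal(L/ℚ)) (Ideal.span {p}) P
  rw [Ideal.ramificationIdxIn_eq_ramificationIdx _ P Gal(L/ℚ)] at h1
  have h2 : P.inertia Gal(L/ℚ) = ⊥ := by
    rw [eq_bot_iff]
    intro g hg
    exact inertia_eq_one_of_even hm hp hp2 hR hsp P hg
  rw [h2, Subgroup.card_bot] at h1
  have hpm' : (P.under ℤ).IsMaximal := by rwa [← P.over_def (Ideal.span {p})]
  have : Finite (ℤ ⧸ P.under ℤ) := by rwa [← P.over_def (Ideal.span {p})]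
  have := perfectField_residueField (P.under ℤ)
  exact Ideal.ramificationIdx_eq_one_iff.1 h1.symm

theorem exists_numberField_isSplittingField (F : ℚ[X]) :
    ∃ (L : Type) (_ : Field L) (_ : NumberField L), IsSplittingField ℚ L F := by
  have : CharZero F.SplittingField := charZero_of_injective_algebraMap (algebraMap ℚ _).injective
  refine ⟨F.SplittingField, inferInstance, @NumberField.mk _ _ inferInstance ?_, ?_⟩
  · convert (inferInstance : FiniteDimensional ℚ F.SplittingField)
  · convert IsSplittingField.splittingField F
    exact Subsingleton.elim _ _

/-- Otherwise the splitting field is unramified at all odd primes, so the root field `K` has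
discriminant `± 2^a`. It divides the discriminant of the polynomial, whose 2-adic valuation is below
`m`; this is too small for a field of degree `m`. -/
theorem exists_prime_odd_valuation_derivRes_bonacci {m : ℕ} (hm : 2 ≤ m) :
    ∃ p : ℤ, Prime p ∧ ¬ p ∣ 2 ∧
      ∃ (a : ℕ) (s : ℤ), derivRes (bonacci m) = p ^ (2 * a + 1) * s ∧ ¬ p ∣ s := by
  by_contra! hcon
  have hmon := bonacci_monic (m := m) (by omega)
  have hirr := bonacci_irreducible_rat hm
  have hD := derivRes_bonacci_ne_zero hm
  set F := (bonacci m).map (algebraMap ℤ ℚ) with hF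
  obtain ⟨L, _, _, _⟩ := exists_numberField_isSplittingField F
  have : IsGalois ℚ L := IsGalois.of_separable_splitting_field (p := F) hirr.separable
  have hL : ∀ p : ℤ, Prime p → ¬ p ∣ 2 → ¬ p ∣ discr L := by
    intro p hp hp2
    have hfm : FiniteMultiplicity p (derivRes (bonacci m)) :=
      FiniteMultiplicity.of_prime_left hp hD
    obtain ⟨s, hs, hsp⟩ := hfm.exists_eq_pow_mul_and_not_dvd
    rcases Nat.even_or_odd' (multiplicity p (derivRes (bonacci m))) with ⟨a, ha | ha⟩
    · rw [ha] at hs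
      exact not_dvd_discr_of_even (L := L) hm hp hp2 hs hsp
    · rw [ha] at hs
      exact absurd (hcon p hp hp2 a s hs) hsp
  obtain ⟨r, hr⟩ := (IsSplittingField.splits L F).exists_eval_eq_zero (by
    rw [degree_map]; exact hirr.degree_pos.ne')
  have hr' : aeval r F = 0 := by rwa [eval_map_algebraMap] at hr
  let K := IntermediateField.adjoin ℚ {r}
  have hK : Module.finrank ℚ K = m := by
    rw [IntermediateField.adjoin.finrank (Algebra.IsIntegral.isIntegral r),
      ← minpoly.eq_of_irreducible_of_monic hirr hr' (hmon.map _), hmon.natDegree_map,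
      bonacci_natDegree (by omega)]
  have hdvd : discr K ∣ derivRes (bonacci m) := by
    have h0 : aeval (IntermediateField.AdjoinSimple.gen ℚ r) (bonacci m) = 0 := by
      apply (algebraMap K L).injective
      rw [map_zero, ← aeval_algebraMap_apply, IntermediateField.AdjoinSimple.algebraMap_gen,
        ← aeval_map_algebraMap ℚ]
      exact hr'
    have hgen : minpoly ℚ (IntermediateField.AdjoinSimple.gen ℚ r) = F :=
      (minpoly.eq_of_irreducible_of_monic hirr (by rwa [hF, aeval_map_algebraMap])
        (hmon.map _)).symm
    refine discr_dvd_derivRes hmon hirr h0 ?_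
    · rw [Field.primitive_element_iff_minpoly_natDegree_eq, hgen, hmon.natDegree_map,
        bonacci_natDegree (by omega), hK]
  have hpow : ∃ a : ℕ, (discr K).natAbs = 2 ^ a := by
    refine ⟨_, Nat.eq_prime_pow_of_unique_prime_dvd (by simpa using discr_ne_zero K)
      fun {q} hq hqd => ?_⟩
    by_contra hq2
    refine hL q (Nat.prime_iff_prime_int.1 hq) (fun h => hq2 ?_)
      ((Int.natCast_dvd.2 hqd).trans (discr_dvd_discr K L))
    exact (Nat.prime_dvd_prime_iff_eq hq Nat.prime_two).1 (by exact_mod_cast h)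
  obtain ⟨a, ha⟩ := hpow
  have hadvd : (2 : ℤ) ^ a ∣ derivRes (bonacci m) := by
    refine dvd_trans ?_ hdvd
    rw [← Int.dvd_natAbs, ha]
    simp
  have ham : a < m := by
    by_contra! hle
    rcases Nat.even_or_odd m with he | ho
    · have := odd_derivRes_bonacci hm he
      rw [← Int.not_even_iff_odd, even_iff_two_dvd] at this
      exact this ((dvd_pow_self 2 (by omega)).trans hadvd)
    · exact not_two_pow_dvd_derivRes_bonacci hm ho ((pow_dvd_pow 2 hle).trans hadvd)
  have hge := abs_discr_ge (K := K) (by omega)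
  rw [hK, Int.abs_eq_natAbs, ha] at hge
  push_cast at hge
  -- With `m = 2 + c` and `π > 3`, the lower bound is at least `(4/9) (9/4)^(2+c) = (9/4)^(1+c)`,
  -- which exceeds `2^(1+c) ≥ 2^a`.
  obtain ⟨c, rfl⟩ := Nat.exists_eq_add_of_le hm
  have h1 : (9 / 4 : ℝ) ≤ 3 * Real.pi / 4 := by linarith [Real.pi_gt_three]
  have h2 : (9 / 4 : ℝ) ^ (2 + c) ≤ (3 * Real.pi / 4) ^ (2 + c) := by gcongr
  have h3 : (2 : ℝ) ^ a ≤ 2 ^ (1 + c) := pow_le_pow_right₀ (by norm_num) (by omega)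
  have h4 : (2 : ℝ) ^ c ≤ (9 / 4) ^ c := by gcongr; norm_num
  have h5 : (0 : ℝ) < 2 ^ c := by positivity
  rw [pow_add] at h2 h3
  nlinarith

end Discriminant

/-! ### Specialization of the thick cycle polynomial, and its Galois group at `y = -1`. -/

theorem thickCyclePoly_eq_X_pow_add {m : ℕ} (j : ℕ) (hm : 1 ≤ m) :
    ∃ q : ℤ[X][X], q.degree < m ∧ thickCyclePoly m j = X ^ m + q := by
  refine ⟨_, ?_, rfl⟩
  rw [← smul_eq_C_mul]
  refine (degree_smul_le _ _).trans_lt ((degree_add_le _ _).trans_lt ?_)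
  exact max_lt (degree_sum_X_pow_lt hm) (degree_C_le.trans_lt (by exact_mod_cast hm))

theorem thickCyclePoly_monic {m : ℕ} (j : ℕ) (hm : 1 ≤ m) : (thickCyclePoly m j).Monic := by
  obtain ⟨q, hq, h⟩ := thickCyclePoly_eq_X_pow_add j hm
  rw [h]
  exact monic_X_pow_add hq

theorem thickCyclePoly_natDegree {m : ℕ} (j : ℕ) (hm : 1 ≤ m) :
    (thickCyclePoly m j).natDegree = m := by
  obtain ⟨q, hq, h⟩ := thickCyclePoly_eq_X_pow_add j hm
  rw [h, natDegree_add_eq_left_of_degree_lt (by rwa [degree_X_pow]), natDegree_X_pow]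

theorem map_eval_neg_one_thickCyclePoly (m : ℕ) {j : ℕ} (hj : Odd j) :
    (thickCyclePoly m j).map (evalRingHom (-1)) = bonacci m := by
  simp [thickCyclePoly, bonacci, Polynomial.map_sum, Nat.not_even_iff_odd.2 hj, sub_eq_add_neg,
    add_assoc]

theorem specializeY_thickCyclePoly (m : ℕ) {j : ℕ} (hj : Odd j) :
    specializeY (-1) (thickCyclePoly m j) = (bonacci m).map (algebraMap ℤ ℚ) := by
  rw [specializeY, ← Polynomial.map_map, map_eval_neg_one_thickCyclePoly m hj]
  rfl

theorem bonacci_exists_isSwap {L : Type*} [Field L] [NumberField L] [IsGalois ℚ L] {m : ℕ}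
    [IsSplittingField ℚ L ((bonacci m).map (algebraMap ℤ ℚ))] [DecidableEq L] (hm : 2 ≤ m) :
    ∃ g : Gal(L/ℚ), (MulAction.toPermHom Gal(L/ℚ)
      (((bonacci m).map (algebraMap ℤ ℚ)).rootSet L) g).IsSwap := by
  obtain ⟨p, hp, hp2, a, s, hR, hs⟩ := exists_prime_odd_valuation_derivRes_bonacci hm
  have hp0 : Ideal.span {p} ≠ ⊥ := by simpa using hp.ne_zero
  have hpm : (Ideal.span {p}).IsMaximal :=
    ((Ideal.span_singleton_prime hp.ne_zero).2 hp).isMaximal hp0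
  have : Finite (ℤ ⧸ Ideal.span {p}) := Ideal.finiteQuotientOfFreeOfNeBot _ hp0
  have := perfectField_residueField (Ideal.span {p})
  have h := exists_isSwap_of_odd ℚ L (NumberField.RingOfIntegers L) (bonacci_monic (by omega)) hp hR hs
    (Ideal.span {p}) rfl fun P _ _ => ?_
  · convert h
  have hP : P.IsMaximal := Ideal.IsMaximal.of_liesOver_isMaximal P (Ideal.span {p})
  refine bonacci_collision (by omega) (bonacci_splits_ringOfIntegers (by omega)) P (Or.inl fun h => ?_)
  have h1 : (2 : ℤ) ∈ P.under ℤ := by simpa [Ideal.mem_comap] using h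
  rw [← P.over_def (Ideal.span {p}), Ideal.mem_span_singleton] at h1
  exact hp2 h1

/-- If the Galois group of a splitting field induces all permutations of the roots, then it is the
symmetric group. -/
theorem nonempty_gal_mulEquiv_perm {K L : Type*} [Field K] [Field L] [Algebra K L] (F : K[X])
    [IsSplittingField K L F] {m : ℕ} (hm : (F.rootSet L).ncard = m)
    (h : Function.Surjective (MulAction.toPermHom Gal(L/K) (F.rootSet L))) :
    Nonempty (F.Gal ≃* Equiv.Perm (Fin m)) := by
  have hbij : Function.Bijective (MulAction.toPermHom Gal(L/K) (F.rootSet L)) :=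
    ⟨(injective_iff_map_eq_one _).2 fun g hg => faithful_rootSet hg, h⟩
  have e1 := MulEquiv.ofBijective _ hbij
  have e2 : Gal(F.SplittingField/K) ≃* Gal(L/K) :=
    AlgEquiv.autCongr (IsSplittingField.algEquiv L F).symm
  have e3 : F.rootSet L ≃ Fin m := Finite.equivFinOfCardEq hm
  exact ⟨(e2.trans e1).trans e3.permCongrHom⟩

theorem ncard_rootSet_of_separable {K L : Type*} [Field K] [Field L] [Algebra K L] {F : K[X]}
    (hF : F.Separable) (hs : (F.map (algebraMap K L)).Splits) :
    (F.rootSet L).ncard = F.natDegree := by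
  rw [← Nat.card_coe_set_eq, Nat.card_eq_fintype_card, card_rootSet_eq_natDegree hF hs]

theorem nonempty_gal_bonacci_mulEquiv_perm {m : ℕ} (hm : m.Prime) :
    Nonempty (((bonacci m).map (algebraMap ℤ ℚ)).Gal ≃* Equiv.Perm (Fin m)) := by
  classical
  have hirr := bonacci_irreducible_rat hm.two_le
  have hmon := bonacci_monic hm.one_le
  obtain ⟨L, _, _, _⟩ := exists_numberField_isSplittingField ((bonacci m).map (algebraMap ℤ ℚ))
  have : IsGalois ℚ L := IsGalois.of_separable_splitting_field hirr.separable
  have hcard : (((bonacci m).map (algebraMap ℤ ℚ)).rootSet L).ncard = m := by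
    rw [ncard_rootSet_of_separable hirr.separable (IsSplittingField.splits L _),
      hmon.natDegree_map, bonacci_natDegree hm.one_le]
  have := isPretransitive_rootSet (L := L) hirr
  refine nonempty_gal_mulEquiv_perm (L := L) _ hcard ?_
  obtain ⟨g, hg⟩ := bonacci_exists_isSwap (L := L) hm.two_le
  refine surjective_of_isSwap_of_prime ?_ hg
  rwa [← Nat.card_eq_fintype_card, Nat.card_coe_set_eq, hcard]

/-! ### A nonconstant factor of odd multiplicity in the discriminant over `ℤ[y]`. -/

theorem exists_common_root_of_derivRes_eq_zero {κ : Type*} [Field κ] [IsAlgClosed κ] {f : κ[X]}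
    (hf : f.Monic) (h : derivRes f = 0) : ∃ r, f.eval r = 0 ∧ (derivative f).eval r = 0 := by
  rw [derivRes_eq_prod hf (IsAlgClosed.splits f), Multiset.prod_eq_zero_iff, Multiset.mem_map] at h
  obtain ⟨r, hr, hr'⟩ := h
  exact ⟨r, (mem_roots'.1 hr).2, hr'⟩

/-- A double root modulo `p` satisfies `2 m r = m + 1`, which would read `0 = 1` if `p ∣ m`. -/
theorem not_dvd_of_dvd_derivRes_bonacci {m p : ℕ} (hm : 1 ≤ m) [Fact p.Prime]
    (h : (p : ℤ) ∣ derivRes (bonacci m)) : ¬ p ∣ m := by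
  intro hpm
  let κ := AlgebraicClosure (ZMod p)
  have hmon := (bonacci_monic hm).map (Int.castRingHom κ)
  have h0 : derivRes ((bonacci m).map (Int.castRingHom κ)) = 0 := by
    rw [derivRes_map _ (bonacci_monic hm), eq_intCast, CharP.intCast_eq_zero_iff κ p]
    exact h
  obtain ⟨r, hr, hr'⟩ := exists_common_root_of_derivRes_eq_zero hmon h0
  have h2 : (X - C r) ^ 2 ∣ (bonacci m).map (Int.castRingHom κ) := by
    rw [← le_rootMultiplicity_iff hmon.ne_zero]
    exact (one_lt_rootMultiplicity_iff_isRoot hmon.ne_zero).2 ⟨hr, hr'⟩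
  have h3 := (two_mul_root_eq hm h2).2.2
  have h4 : (m : κ) = 0 := (CharP.cast_eq_zero_iff κ p m).2 hpm
  simp [h4] at h3

/-- At `y = 0` the polynomial times `x - 1` is `x^(m+1) - x`; a double root would be nonzero with
`r^m = 1`, and the derivative then gives `m = 0` in `κ`. This prevents `p` from dividing the content
of the discriminant. -/
theorem not_dvd_eval_zero_derivRes_thickCyclePoly {m p : ℕ} (hm : 1 ≤ m) {j : ℕ} (hj : 1 ≤ j)
    [Fact p.Prime] (hpm : ¬ p ∣ m) : ¬ (p : ℤ) ∣ (derivRes (thickCyclePoly m j)).eval 0 := by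
  intro h
  let κ := AlgebraicClosure (ZMod p)
  let φ := (Int.castRingHom κ).comp (evalRingHom 0)
  have hT := thickCyclePoly_monic j hm
  have h0 : derivRes ((thickCyclePoly m j).map φ) = 0 := by
    rw [derivRes_map _ hT, RingHom.comp_apply, eq_intCast, CharP.intCast_eq_zero_iff κ p]
    exact h
  obtain ⟨r, hr, hr'⟩ := exists_common_root_of_derivRes_eq_zero (hT.map φ) h0
  have hj0 : φ (∑ i ∈ Finset.range j, X ^ i) = 1 := by
    obtain ⟨j, rfl⟩ := Nat.exists_eq_add_of_le' hj
    simp [φ, Finset.sum_range_succ', eval_finsetSum]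
  have hT' : (X - 1) * (thickCyclePoly m j).map φ = X ^ (m + 1) - X := by
    have h1 : (thickCyclePoly m j).map φ = X * ∑ i ∈ Finset.range m, X ^ i := by
      obtain ⟨m, rfl⟩ := Nat.exists_eq_add_of_le' hm
      rw [thickCyclePoly, Polynomial.map_add, Polynomial.map_mul, map_C, hj0]
      simp only [Finset.sum_range_succ, Polynomial.map_sum,
        Polynomial.map_add, map_C, Nat.add_sub_cancel, pow_succ', Finset.mul_sum, mul_add]
      simp [φ]
      ring
    rw [h1, mul_left_comm, mul_comm (X - 1), geom_sum_mul]
    ring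
  have e1 := congrArg (eval r) hT'
  have e2 := congrArg (fun q => eval r (derivative q)) hT'
  simp only [derivative_mul, derivative_sub, derivative_X, derivative_one, derivative_X_pow,
    eval_add, eval_mul, eval_sub, eval_X, eval_one, eval_pow, hr, hr', eval_C,
    Nat.add_sub_cancel, mul_zero, add_zero] at e1 e2
  have hr0 : r ≠ 0 := by
    rintro rfl
    simp [show m ≠ 0 by omega] at e2
  have hrm : r ^ m = 1 := by
    have : r * (r ^ m - 1) = 0 := by linear_combination -e1
    exact sub_eq_zero.1 ((mul_eq_zero.1 this).resolve_left hr0)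
  rw [hrm] at e2
  have : (m : κ) = 0 := by
    push_cast at e2
    linear_combination -e2
  exact hpm ((CharP.cast_eq_zero_iff κ p m).1 this)

theorem dvd_of_sq_mul_eq {A : Type*} [CommRing A] [IsDomain A] {p s t : A} (hp : Prime p)
    (hs : ¬ p ∣ s) {a : ℕ} {W : A} (h : W ^ 2 * t = p ^ (2 * a + 1) * s) : p ∣ t := by
  induction a generalizing W with
  | zero =>
    refine (hp.dvd_or_dvd (h ▸ ⟨s, by ring⟩ : p ∣ W ^ 2 * t)).resolve_left fun hW => hs ?_
    obtain ⟨w, rfl⟩ := hp.dvd_of_dvd_pow hW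
    exact ⟨w ^ 2 * t, mul_left_cancel₀ hp.ne_zero (by linear_combination -h)⟩
  | succ a ih =>
    refine (hp.dvd_or_dvd (h ▸ ⟨p ^ (2 * a + 2) * s, by ring⟩ : p ∣ W ^ 2 * t)).elim
      (fun hW => ?_) id
    obtain ⟨w, rfl⟩ := hp.dvd_of_dvd_pow hW
    exact ih (W := w) (mul_left_cancel₀ (pow_ne_zero 2 hp.ne_zero) (by linear_combination h))

/-- If the valuation of `φ Δ` is odd then `Δ` has an irreducible factor of odd multiplicity whose
image is not a unit at `p`. -/
theorem exists_irreducible_odd_multiplicity {R A : Type*} [CommRing R] [IsDomain R]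
    [UniqueFactorizationMonoid R] [CommRing A] [IsDomain A] (φ : R →+* A) {p s : A} (hp : Prime p)
    (hs : ¬ p ∣ s) {a : ℕ} {Δ : R} (h : φ Δ = p ^ (2 * a + 1) * s) :
    ∃ g : R, Irreducible g ∧ p ∣ φ g ∧ ∃ (c : ℕ) (q : R), Δ = g ^ (2 * c + 1) * q ∧ ¬ g ∣ q := by
  classical
  let := UniqueFactorizationMonoid.strongNormalizationMonoid (α := R)
  have hΔ : Δ ≠ 0 := by
    rintro rfl
    rw [map_zero, eq_comm, mul_eq_zero] at h
    exact h.elim (pow_ne_zero _ hp.ne_zero) (fun h => hs (h ▸ dvd_zero p))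
  set M := UniqueFactorizationMonoid.normalizedFactors Δ with hM
  obtain ⟨u, hu⟩ := UniqueFactorizationMonoid.prod_normalizedFactors hΔ
  -- Up to a unit, `Δ` is split into a square and the product of its factors of odd multiplicity;
  -- only the latter can account for an odd power of `p`.
  rw [← hM, Finset.prod_multiset_count, Finset.prod_congr rfl fun g _ => by
    rw [← Nat.div_add_mod' (M.count g) 2, pow_add, pow_mul], Finset.prod_mul_distrib,
    Finset.prod_pow] at hu
  rw [← hu, map_mul, map_mul, map_pow, mul_assoc] at h
  rcases hp.dvd_or_dvd (dvd_of_sq_mul_eq hp hs h) with h1 | h1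
  · rw [map_prod, hp.dvd_finsetProd_iff] at h1
    obtain ⟨g, hg, hpg⟩ := h1
    rw [Multiset.mem_toFinset] at hg
    have hirr := UniqueFactorizationMonoid.irreducible_of_normalized_factor g hg
    rw [map_pow] at hpg
    refine ⟨g, hirr, hp.dvd_of_dvd_pow hpg, ?_⟩
    have hodd : M.count g % 2 = 1 := by
      rcases Nat.mod_two_eq_zero_or_one (M.count g) with h0 | h0
      · rw [h0, pow_zero] at hpg
        exact absurd (isUnit_of_dvd_one hpg) hp.not_isUnit
      · exact h0
    have hmul := UniqueFactorizationMonoid.emultiplicity_eq_count_normalizedFactors hirr hΔ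
    rw [UniqueFactorizationMonoid.normalize_normalized_factor g hg, ← hM] at hmul
    obtain ⟨hdvd, hnd⟩ := emultiplicity_eq_coe.1 hmul
    obtain ⟨q, hq⟩ := hdvd
    refine ⟨M.count g / 2, q, ?_, ?_⟩
    · rw [hq]
      congr 2
      omega
    · rintro ⟨q', rfl⟩
      exact hnd ⟨q', by rw [hq]; ring⟩
  · exact absurd (isUnit_of_dvd_unit h1 (u.isUnit.map φ)) hp.not_isUnit

theorem exists_odd_factor_derivRes_thickCyclePoly {m : ℕ} (hm : 2 ≤ m) {j : ℕ} (hj : Odd j) :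
    ∃ p : ℕ, p.Prime ∧ p ≠ 2 ∧ ∃ h : ℤ[X], Irreducible h ∧ 0 < h.natDegree ∧
      (p : ℤ) ∣ h.eval (-1) ∧ ∃ (c : ℕ) (q : ℤ[X]),
        derivRes (thickCyclePoly m j) = h ^ (2 * c + 1) * q ∧ ¬ h ∣ q := by
  obtain ⟨p', hp', hp2, a, s, hR, hs⟩ := exists_prime_odd_valuation_derivRes_bonacci hm
  have hT := thickCyclePoly_monic j (by omega : 1 ≤ m)
  rw [← map_eval_neg_one_thickCyclePoly m hj, derivRes_map _ hT] at hR
  obtain ⟨h, hirr, hdvd, c, q, hq, hnd⟩ :=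
    exists_irreducible_odd_multiplicity (evalRingHom (-1)) hp' hs hR
  have hpn : p'.natAbs.Prime := Int.prime_iff_natAbs_prime.1 hp'
  refine ⟨p'.natAbs, hpn, ?_, h, hirr, ?_, Int.natAbs_dvd.2 hdvd, c, q, hq, hnd⟩
  · intro h2
    exact hp2 (Int.natAbs_dvd.1 (by rw [h2]; rfl))
  · by_contra h0
    -- A constant factor would be divisible by `p`, and `p` would then divide the discriminant at `y
    -- = 0` too.
    obtain ⟨z, rfl⟩ : ∃ z, h = C z := ⟨_, eq_C_of_natDegree_eq_zero (by omega)⟩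
    have hz : p' ∣ z := by simpa using hdvd
    have : Fact p'.natAbs.Prime := ⟨hpn⟩
    refine not_dvd_eval_zero_derivRes_thickCyclePoly (m := m) (p := p'.natAbs) (by omega) hj.pos
      (not_dvd_of_dvd_derivRes_bonacci (by omega) ?_) ?_
    · rw [← map_eval_neg_one_thickCyclePoly m hj, derivRes_map _ hT, hR, Int.natAbs_dvd]
      exact ⟨p' ^ (2 * a) * s, by ring⟩
    · rw [Int.natAbs_dvd, hq, eval_mul, eval_pow, eval_C]
      exact (hz.trans (dvd_pow_self _ (by omega))).mul_right _

/-! ### Irreducible integral polynomials over fields of characteristic zero. -/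

section IntPolynomial

variable {h : ℤ[X]}

theorem irreducible_map_rat (hirr : Irreducible h) (hdeg : 0 < h.natDegree) :
    Irreducible (h.map (algebraMap ℤ ℚ)) :=
  (hirr.isPrimitive hdeg.ne').irreducible_iff_irreducible_map_fraction_map.1 hirr

theorem dvd_of_map_rat_dvd (hirr : Irreducible h) (hdeg : 0 < h.natDegree) {g : ℤ[X]}
    (hg : h.map (algebraMap ℤ ℚ) ∣ g.map (algebraMap ℤ ℚ)) : h ∣ g := by
  obtain ⟨q, hq⟩ := hg
  obtain ⟨b, hb, hbq⟩ := IsLocalization.integerNormalization_spec (nonZeroDivisors ℤ) q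
  have hb0 := nonZeroDivisors.ne_zero hb
  have h1 : C b * g = h * IsLocalization.integerNormalization (nonZeroDivisors ℤ) q := by
    apply map_injective _ (algebraMap ℤ ℚ).injective_int
    rw [Polynomial.map_mul, Polynomial.map_mul, hbq, hq, map_C, Algebra.smul_def,
      mul_left_comm]
    rfl
  refine (hirr.prime.dvd_or_dvd (⟨_, h1⟩ : h ∣ C b * g)).resolve_left fun hd => ?_
  have := natDegree_le_of_dvd hd (by simpa using hb0)
  rw [natDegree_C] at this
  omega

theorem isCoprime_map_rat (hirr : Irreducible h) (hdeg : 0 < h.natDegree) {g : ℤ[X]}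
    (hg : ¬ h ∣ g) : IsCoprime (h.map (algebraMap ℤ ℚ)) (g.map (algebraMap ℤ ℚ)) :=
  (irreducible_map_rat hirr hdeg).coprime_iff_not_dvd.2 fun hd => hg (dvd_of_map_rat_dvd hirr hdeg hd)

theorem isCoprime_map_intCast {K : Type*} [Field K] [CharZero K] (hirr : Irreducible h)
    (hdeg : 0 < h.natDegree) {g : ℤ[X]} (hg : ¬ h ∣ g) :
    IsCoprime (h.map (Int.castRingHom K)) (g.map (Int.castRingHom K)) := by
  have := (isCoprime_map_rat hirr hdeg hg).map (mapRingHom (algebraMap ℚ K))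
  simpa only [coe_mapRingHom, Polynomial.map_map, RingHom.ext_int (RingHom.comp _ _)
    (Int.castRingHom K)] using this

theorem separable_map_intCast {K : Type*} [Field K] [CharZero K] (hirr : Irreducible h)
    (hdeg : 0 < h.natDegree) : (h.map (Int.castRingHom K)).Separable := by
  have := (irreducible_map_rat hirr hdeg).separable.map (f := algebraMap ℚ K)
  rwa [Polynomial.map_map, RingHom.ext_int (RingHom.comp _ _) (Int.castRingHom K)] at this

/-- The integral polynomials vanishing at a root of an irreducible `h` are the multiples of `h`. -/
theorem dvd_of_aeval_eq_zero {κ : Type*} [CommRing κ] [IsDomain κ] [CharZero κ]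
    (hirr : Irreducible h) (hdeg : 0 < h.natDegree) {y : κ} (hy : aeval y h = 0) {g : ℤ[X]}
    (hg : aeval y g = 0) : h ∣ g := by
  by_contra hnd
  let E := FractionRing κ
  have : CharZero E := charZero_of_injective_algebraMap (IsFractionRing.injective κ E)
  obtain ⟨u, v, huv⟩ := isCoprime_map_intCast (K := E) hirr hdeg hnd
  have h0 : ∀ g : ℤ[X], aeval y g = 0 →
      (g.map (Int.castRingHom E)).eval (algebraMap κ E y) = 0 := by
    intro g hg
    have := aeval_algebraMap_apply E y g
    rw [hg, map_zero] at this
    rw [← this, eval_map, aeval_def, RingHom.ext_int (algebraMap ℤ E) (Int.castRingHom E)]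
  have := congrArg (eval (algebraMap κ E y)) huv
  simp [h0 h hy, h0 g hg] at this

end IntPolynomial

/-! ### Collisions at a zero of the odd factor. -/

/-- The roots are integral over `ℤ[y]` and can be reduced once more, at a prime above the ideal `N`
of polynomials `g` with `p ∣ g(-1)`. Such a prime exists because all relations of `y` are multiples
of `h`, and `h ∈ N`. The reduction is `bonacci m` with `2 ≠ 0`, which loses at most one root, and
reduction cannot increase the number of distinct roots. -/
theorem thickCyclePoly_card_le {κ : Type*} [CommRing κ] [IsDomain κ] [CharZero κ] [DecidableEq κ]
    {h : ℤ[X]} (hirr : Irreducible h) (hdeg : 0 < h.natDegree) {y : κ} (hy : aeval y h = 0)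
    {p : ℕ} (hp : p.Prime) (hp2 : p ≠ 2) (hph : (p : ℤ) ∣ h.eval (-1)) {m j : ℕ} (hm : 1 ≤ m)
    (hj : Odd j) {s : Multiset κ}
    (hs : (thickCyclePoly m j).map (aeval y : ℤ[X] →ₐ[ℤ] κ).toRingHom =
      (s.map fun r => X - C r).prod) : s.card ≤ s.toFinset.card + 1 := by
  classical
  let := (aeval y : ℤ[X] →ₐ[ℤ] κ).toRingHom.toAlgebra
  have hT := thickCyclePoly_monic j hm
  let R := integralClosure ℤ[X] κ
  let N : Ideal ℤ[X] := (Ideal.span {(p : ℤ)}).comap (evalRingHom (-1))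
  have hpZ : Prime (p : ℤ) := Nat.prime_iff_prime_int.1 hp
  have hmemN : ∀ g, g ∈ N ↔ (p : ℤ) ∣ g.eval (-1) := fun g => by
    rw [Ideal.mem_comap, Ideal.mem_span_singleton]
    rfl
  have hpr : (Ideal.span {(p : ℤ)}).IsPrime := (Ideal.span_singleton_prime hpZ.ne_zero).2 hpZ
  have hNp : N.IsPrime := Ideal.comap_isPrime _ _
  have hle : (⊥ : Ideal R).comap (algebraMap ℤ[X] R) ≤ N := by
    intro g hg
    have hg0 : aeval y g = 0 := congrArg (algebraMap R κ) (Ideal.mem_bot.1 (Ideal.mem_comap.1 hg))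
    rw [hmemN]
    obtain ⟨q, rfl⟩ := dvd_of_aeval_eq_zero hirr hdeg hy hg0
    rw [eval_mul]
    exact hph.mul_right _
  obtain ⟨Q, -, hQ, hQN⟩ := Ideal.exists_ideal_over_prime_of_isIntegral N (⊥ : Ideal R) hle
  let E := FractionRing (R ⧸ Q)
  let ψ : R →+* E := (algebraMap (R ⧸ Q) E).comp (Ideal.Quotient.mk Q)
  have hψ0 : ∀ g : ℤ[X], ψ (algebraMap ℤ[X] R g) = 0 ↔ (p : ℤ) ∣ g.eval (-1) := by
    intro g
    rw [← hmemN, ← hQN, Ideal.mem_comap, ← Ideal.Quotient.eq_zero_iff_mem]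
    exact map_eq_zero_iff _ (IsFractionRing.injective (R ⧸ Q) E)
  have hψ : ψ.comp (algebraMap ℤ[X] R) = (Int.castRingHom E).comp (evalRingHom (-1)) := by
    refine Polynomial.ringHom_ext' (RingHom.ext_int _ _) ?_
    have h1 := (hψ0 (X + 1)).2 (by simp)
    rw [map_add, map_add, map_one, map_one] at h1
    rw [RingHom.comp_apply, eq_neg_of_add_eq_zero_left h1]
    simp
  have hE2 : (2 : E) ≠ 0 := by
    intro h0
    have h1 := (hψ0 2).1 (by rw [map_ofNat, map_ofNat, h0])
    rw [eval_ofNat] at h1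
    exact hp2 ((Nat.prime_dvd_prime_iff_eq hp Nat.prime_two).1 (by exact_mod_cast h1))
  have hint : ∀ r ∈ s, IsIntegral ℤ[X] r := by
    intro r hr
    refine ⟨thickCyclePoly m j, hT, ?_⟩
    rw [← eval_map]
    change eval r ((thickCyclePoly m j).map (aeval y : ℤ[X] →ₐ[ℤ] κ).toRingHom) = 0
    rw [hs, eval_multiset_prod, Multiset.prod_eq_zero_iff, Multiset.map_map]
    exact Multiset.mem_map.2 ⟨r, hr, by simp⟩
  obtain ⟨t, ht⟩ : ∃ t : Multiset R, t.map (algebraMap R κ) = s :=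
    CanLift.prf (β := Multiset R) s hint
  have hinj : Function.Injective (algebraMap R κ) := Subtype.val_injective
  have hTR : (thickCyclePoly m j).map (algebraMap ℤ[X] R) = (t.map fun r => X - C r).prod := by
    apply map_injective _ hinj
    rw [Polynomial.map_map, ← IsScalarTower.algebraMap_eq, Polynomial.map_multiset_prod,
      Multiset.map_map]
    refine hs.trans ?_
    rw [← ht, Multiset.map_map]
    simp
    rfl
  have hTE : (bonacci m).map (Int.castRingHom E) = ((t.map ψ).map fun r => X - C r).prod := by
    rw [← map_eval_neg_one_thickCyclePoly m hj, Polynomial.map_map, ← hψ, ← Polynomial.map_map,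
      hTR, Polynomial.map_multiset_prod, Multiset.map_map, Multiset.map_map]
    simp
  have := card_le_card_toFinset_add_one_of_bonacci' hm (Or.inl hE2) hTE
  rw [← ht, Multiset.card_map]
  rw [Multiset.card_map] at this
  refine this.trans (Nat.add_le_add_right ?_ 1)
  rw [Multiset.toFinset_map, Multiset.toFinset_map, Finset.card_image_of_injective _ hinj]
  exact Finset.card_image_le

/-! ### A transposition over `K(y)`. -/

/-- The Tutte polynomial of the thick cycle over `K[y]`. -/
def thickCyclePolyOver (K : Type*) [Field K] (m j : ℕ) : K[X][X] :=
  (thickCyclePoly m j).map (mapRingHom (Int.castRingHom K))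

theorem thickCyclePolyOver_monic (K : Type*) [Field K] {m : ℕ} (j : ℕ) (hm : 1 ≤ m) :
    (thickCyclePolyOver K m j).Monic :=
  (thickCyclePoly_monic j hm).map _

theorem map_thickCyclePolyOver (K : Type*) [Field K] (m j : ℕ) :
    (thickCyclePolyOver K m j).map (algebraMap K[X] (RatFunc K)) =
      overRatFunc K (thickCyclePoly m j) := by
  rw [thickCyclePolyOver, Polynomial.map_map]
  rfl

/-- Over `K` the factor `h` may split, but it stays squarefree and coprime to `q`, so each of its
prime factors inherits the multiplicity `2 * c + 1`. -/
theorem exists_odd_factor_derivRes_thickCyclePolyOver (K : Type*) [Field K] [CharZero K] {h q : ℤ[X]}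
    (hirr : Irreducible h) (hdeg : 0 < h.natDegree) (hq : ¬ h ∣ q) {m : ℕ} (hm : 1 ≤ m) {j c : ℕ}
    (hD : derivRes (thickCyclePoly m j) = h ^ (2 * c + 1) * q) :
    ∃ π : K[X], Prime π ∧ π ∣ h.map (Int.castRingHom K) ∧ ∃ s : K[X],
      derivRes (thickCyclePolyOver K m j) = π ^ (2 * c + 1) * s ∧ ¬ π ∣ s := by
  set hK := h.map (Int.castRingHom K) with hK_def
  have hsep : hK.Separable := separable_map_intCast hirr hdeg
  have hnu : ¬ IsUnit hK := by
    intro hu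
    have := natDegree_eq_zero_of_isUnit hu
    rw [natDegree_map_eq_of_injective (Int.castRingHom K).injective_int] at this
    omega
  obtain ⟨π, hπ, hdvd⟩ := WfDvdMonoid.exists_irreducible_factor hnu hsep.ne_zero
  obtain ⟨r, hr⟩ := id hdvd
  refine ⟨π, hπ.prime, hdvd, r ^ (2 * c + 1) * q.map (Int.castRingHom K), ?_, fun hs => ?_⟩
  · rw [thickCyclePolyOver, derivRes_map _ (thickCyclePoly_monic j hm), hD, map_mul, map_pow]
    change hK ^ _ * _ = _
    rw [hr, mul_pow, mul_assoc]
    rfl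
  · rcases hπ.prime.dvd_or_dvd hs with h1 | h1
    · obtain ⟨r', rfl⟩ := hπ.prime.dvd_of_dvd_pow h1
      exact hπ.not_isUnit (hsep.squarefree π ⟨r', by rw [hr, mul_assoc]⟩)
    · exact hπ.not_isUnit ((isCoprime_map_intCast hirr hdeg hq).isUnit_of_dvd' hdvd h1)

/-- `K` is any field of characteristic zero so that the result also applies to an algebraic closure
of `k`, where it provides a geometric transposition. -/
theorem exists_isSwap_overRatFunc {K L : Type*} [Field K] [CharZero K] [Field L]
    [Algebra (RatFunc K) L] {m j : ℕ} (hm : 2 ≤ m) (hj : Odd j)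
    [IsSplittingField (RatFunc K) L (overRatFunc K (thickCyclePoly m j))]
    [IsGalois (RatFunc K) L] [DecidableEq L] :
    ∃ g : Gal(L/RatFunc K), (MulAction.toPermHom Gal(L/RatFunc K)
      ((overRatFunc K (thickCyclePoly m j)).rootSet L) g).IsSwap := by
  classical
  obtain ⟨p, hp, hp2, h, hirr, hdeg, hph, c, q, hD, hq⟩ :=
    exists_odd_factor_derivRes_thickCyclePoly hm hj
  obtain ⟨π, hπ, hπh, s, hR, hs⟩ :=
    exists_odd_factor_derivRes_thickCyclePolyOver K hirr hdeg hq (by omega) hD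
  have hf := thickCyclePolyOver_monic K j (by omega : 1 ≤ m)
  have hfL := map_thickCyclePolyOver K m j
  have : FiniteDimensional (RatFunc K) L :=
    IsSplittingField.finiteDimensional L (overRatFunc K (thickCyclePoly m j))
  have hsplit : IsSplittingField (RatFunc K) L
      ((thickCyclePolyOver K m j).map (algebraMap K[X] (RatFunc K))) := by rwa [hfL]
  let : Algebra K[X] L := ((algebraMap (RatFunc K) L).comp (algebraMap K[X] (RatFunc K))).toAlgebra
  have : IsScalarTower K[X] (RatFunc K) L := IsScalarTower.of_algebraMap_eq fun _ => rfl
  let B := integralClosure K[X] L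
  have : IsDedekindDomain B := integralClosure.isDedekindDomain K[X] (RatFunc K) L
  let := IsIntegralClosure.MulSemiringAction K[X] (RatFunc K) L B
  have : SMulDistribClass Gal(L/RatFunc K) B L := inferInstance
  set P := Ideal.span {π} with hP
  have hPp : P.IsPrime := (Ideal.span_singleton_prime hπ.ne_zero).2 hπ
  have : CharZero P.ResidueField :=
    charZero_of_injective_ringHom ((algebraMap K[X] P.ResidueField).comp C).injective
  have hB := splits_integralClosure (RatFunc K) L B hf (IsSplittingField.splits L _)
  have key := exists_isSwap_of_odd (RatFunc K) L B hf hπ hR hs P hP fun Q _ _ => ?_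
  · rw [hfL] at key
    convert key
  refine (ncard_rootSet_le_natDegree _).trans ?_
  have hs' := hB.map (Ideal.Quotient.mk Q)
  rw [Polynomial.map_map, show (Ideal.Quotient.mk Q).comp (algebraMap K[X] B) =
    algebraMap K[X] (B ⧸ Q) from rfl] at hs'
  have : CharZero (B ⧸ Q) :=
    charZero_of_injective_ringHom ((algebraMap K[X] (B ⧸ Q)).comp C).injective
  -- The residue class of the variable is a zero of `h`, since `Q` lies above a factor `π` of `h`.
  set y := algebraMap K[X] (B ⧸ Q) X with hy_def
  have hcomp : (algebraMap K[X] (B ⧸ Q)).comp (mapRingHom (Int.castRingHom K)) =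
      (aeval y : ℤ[X] →ₐ[ℤ] B ⧸ Q).toRingHom :=
    Polynomial.ringHom_ext' (RingHom.ext_int _ _) (by simp [y])
  have hy : aeval y h = 0 := by
    have h1 : algebraMap K[X] (B ⧸ Q) (h.map (Int.castRingHom K)) = 0 := by
      rw [IsScalarTower.algebraMap_apply K[X] B (B ⧸ Q)]
      refine Ideal.Quotient.eq_zero_iff_mem.2 ?_
      change _ ∈ Q.under K[X]
      rw [← Q.over_def P, hP, Ideal.mem_span_singleton]
      exact hπh
    exact (RingHom.congr_fun hcomp h).symm.trans h1
  have h1 := hs'.eq_prod_roots_of_monic (hf.map _)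
  have h2 := thickCyclePoly_card_le hirr hdeg hy hp hp2 hph (m := m) (by omega) hj (s :=
    ((thickCyclePolyOver K m j).map (algebraMap K[X] (B ⧸ Q))).roots) (by
      rw [← h1, thickCyclePolyOver, Polynomial.map_map, hcomp]; rfl)
  rwa [← hs'.natDegree_eq_card_roots, hf.natDegree_map, ← aroots_def,
    ← Set.ncard_coe_finset, ← rootSet_def] at h2

/-! ### Irreducibility over `K(y)`. -/

theorem coeff_X_pow_add_C_mul_sum {R : Type*} [CommRing R] {m : ℕ} (c d : R) {n : ℕ} (hn : n < m) :
    (X ^ m + C c * (∑ i ∈ Finset.range (m - 1), X ^ (i + 1) + C d) : R[X]).coeff n =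
      c * if n = 0 then d else 1 := by
  rw [coeff_add, coeff_X_pow, if_neg hn.ne, zero_add, coeff_C_mul, coeff_add, finsetSum_coeff]
  congr 1
  rcases Nat.eq_zero_or_pos n with rfl | h0
  · simp [coeff_X_pow]
  · rw [Finset.sum_eq_single (n - 1)]
    · rw [coeff_X_pow, if_pos (by omega), coeff_C, if_neg h0.ne', if_neg h0.ne', add_zero]
    · intro i _ hi
      rw [coeff_X_pow, if_neg (by omega)]
    · intro h
      exact absurd (Finset.mem_range.2 (by omega)) h

theorem thickCyclePolyOver_eq (K : Type*) [Field K] (m j : ℕ) :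
    thickCyclePolyOver K m j = X ^ m + C (∑ i ∈ Finset.range j, X ^ i) *
      (∑ i ∈ Finset.range (m - 1), X ^ (i + 1) + C X) := by
  simp [thickCyclePolyOver, thickCyclePoly, Polynomial.map_sum]

/-- Eisenstein at a prime factor `π` of `c = 1 + ⋯ + y^(j-1)`, which is nonconstant for `j ≥ 2`. All
lower coefficients are multiples of `c`. The constant one is `c y`, and `π^2` does not divide it
because `c` divides the separable `y^j - 1`. -/
theorem thickCyclePolyOver_irreducible_of_eisenstein (K : Type*) [Field K] [CharZero K] {m j : ℕ}
    (hm : 1 ≤ m) (hj : 2 ≤ j) : Irreducible (thickCyclePolyOver K m j) := by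
  set c : K[X] := ∑ i ∈ Finset.range j, X ^ i with hc
  have hcg : c * (X - 1) = X ^ j - 1 := geom_sum_mul X j
  have hsep : c.Separable := by
    refine Separable.of_mul_left (f := c) (g := X - 1) ?_
    rw [hcg, ← C_1]
    exact separable_X_pow_sub_C 1 (by exact_mod_cast (by omega : j ≠ 0)) one_ne_zero
  have hnu : ¬ IsUnit c := by
    intro hu
    have h1 := congrArg natDegree hcg
    rw [← C_1, natDegree_mul hsep.ne_zero (X_sub_C_ne_zero 1), natDegree_eq_zero_of_isUnit hu,
      natDegree_X_pow_sub_C, natDegree_X_sub_C] at h1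
    omega
  obtain ⟨π, hπ, hdvd⟩ := WfDvdMonoid.exists_irreducible_factor hnu hsep.ne_zero
  have hπX : ¬ π ∣ X := by
    intro h
    refine hπ.not_isUnit (isUnit_of_dvd_one ?_)
    have h1 : π ∣ X ^ j - 1 := hcg ▸ hdvd.mul_right _
    exact (dvd_sub_right (h.trans (dvd_pow_self X (by omega)))).1 h1
  have hmon := thickCyclePolyOver_monic K j hm
  have hdeg : (thickCyclePolyOver K m j).degree = m := by
    rw [degree_eq_natDegree hmon.ne_zero, thickCyclePolyOver, (thickCyclePoly_monic j hm).natDegree_map,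
      thickCyclePoly_natDegree j hm]
  have hpr : (Ideal.span {π}).IsPrime := (Ideal.span_singleton_prime hπ.ne_zero).2 hπ.prime
  refine irreducible_of_eisenstein_criterion hpr ?_ ?_ ?_ ?_ hmon.isPrimitive
  · rw [hmon.leadingCoeff, ← Ideal.ne_top_iff_one]
    exact hpr.ne_top
  · intro n hn
    rw [hdeg] at hn
    rw [thickCyclePolyOver_eq, coeff_X_pow_add_C_mul_sum _ _ (by exact_mod_cast hn)]
    exact Ideal.mul_mem_right _ _ (Ideal.mem_span_singleton.2 hdvd)
  · rw [hdeg]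
    exact_mod_cast hm
  · rw [thickCyclePolyOver_eq, coeff_X_pow_add_C_mul_sum _ _ (by omega), if_pos rfl,
      Ideal.span_singleton_pow, Ideal.mem_span_singleton, pow_two, ← hc]
    intro h
    obtain ⟨r, hr⟩ := id hdvd
    rw [hr, mul_assoc, mul_dvd_mul_iff_left hπ.ne_zero] at h
    rcases hπ.prime.dvd_or_dvd h with ⟨r', rfl⟩ | h
    · exact hπ.not_isUnit (hsep.squarefree π ⟨r', by rw [hr, mul_assoc]⟩)
    · exact hπX h

/-- For `j = 1` Eisenstein is not available, but the polynomial is monic of degree one in `y`. -/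
theorem thickCyclePolyOver_one_irreducible (K : Type*) [Field K] (m : ℕ) :
    Irreducible (thickCyclePolyOver K m 1) := by
  rw [← MulEquiv.irreducible_iff (Bivariate.swap (R := K))]
  have : Bivariate.swap (thickCyclePolyOver K m 1) =
      X - C (-(X ^ m + ∑ i ∈ Finset.range (m - 1), X ^ (i + 1))) := by
    simp [thickCyclePolyOver_eq, Bivariate.swap_X, Bivariate.swap_Y]
    ring
  rw [this]
  exact (prime_X_sub_C _).irreducible

theorem overRatFunc_thickCyclePoly_irreducible (K : Type*) [Field K] [CharZero K] {m j : ℕ}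
    (hm : 1 ≤ m) (hj : 1 ≤ j) : Irreducible (overRatFunc K (thickCyclePoly m j)) := by
  rw [← map_thickCyclePolyOver,
    ← (thickCyclePolyOver_monic K j hm).irreducible_iff_irreducible_map_fraction_map]
  obtain rfl | hj := hj.eq_or_lt
  · exact thickCyclePolyOver_one_irreducible K m
  · exact thickCyclePolyOver_irreducible_of_eisenstein K hm hj

theorem overRatFunc_thickCyclePoly_natDegree (K : Type*) [Field K] {m : ℕ} (j : ℕ) (hm : 1 ≤ m) :
    (overRatFunc K (thickCyclePoly m j)).natDegree = m := by
  rw [overRatFunc, (thickCyclePoly_monic j hm).natDegree_map, thickCyclePoly_natDegree j hm]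

theorem ncard_rootSet_overRatFunc_thickCyclePoly {K : Type*} (L : Type*) [Field K] [CharZero K]
    [Field L] [Algebra (RatFunc K) L] {m j : ℕ} (hm : 1 ≤ m) (hj : 1 ≤ j)
    [IsSplittingField (RatFunc K) L (overRatFunc K (thickCyclePoly m j))] :
    ((overRatFunc K (thickCyclePoly m j)).rootSet L).ncard = m := by
  have hirr := overRatFunc_thickCyclePoly_irreducible K hm hj
  have : CharZero (RatFunc K) := charZero_of_injective_algebraMap (algebraMap K _).injective
  rw [ncard_rootSet_of_separable hirr.separable (IsSplittingField.splits L _),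
    overRatFunc_thickCyclePoly_natDegree K j hm]

theorem isGalois_of_isSplittingField_overRatFunc {K : Type*} (L : Type*) [Field K] [CharZero K]
    [Field L] [Algebra (RatFunc K) L] {m j : ℕ} (hm : 1 ≤ m) (hj : 1 ≤ j)
    [IsSplittingField (RatFunc K) L (overRatFunc K (thickCyclePoly m j))] :
    IsGalois (RatFunc K) L := by
  have : CharZero (RatFunc K) := charZero_of_injective_algebraMap (algebraMap K _).injective
  exact IsGalois.of_separable_splitting_field
    (overRatFunc_thickCyclePoly_irreducible K hm hj).separable

/-! ### Prime degree over `K(y)`, and the permutation model. -/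

theorem surjective_toPermHom_overRatFunc_of_prime {K L : Type*} [Field K] [CharZero K] [Field L]
    [Algebra (RatFunc K) L] {m j : ℕ} (hm : m.Prime) (hj : Odd j)
    [IsSplittingField (RatFunc K) L (overRatFunc K (thickCyclePoly m j))] :
    Function.Surjective (MulAction.toPermHom Gal(L/RatFunc K)
      ((overRatFunc K (thickCyclePoly m j)).rootSet L)) := by
  classical
  have := isGalois_of_isSplittingField_overRatFunc (K := K) L hm.one_le hj.pos
  have := isPretransitive_rootSet (L := L)
    (overRatFunc_thickCyclePoly_irreducible K hm.one_le hj.pos)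
  obtain ⟨g, hg⟩ := exists_isSwap_overRatFunc (K := K) (L := L) hm.two_le hj
  refine surjective_of_isSwap_of_prime ?_ hg
  rwa [← Nat.card_eq_fintype_card, Nat.card_coe_set_eq,
    ncard_rootSet_overRatFunc_thickCyclePoly (K := K) L hm.one_le hj.pos]

/-- The Galois group of a splitting field, as a permutation group of `Fin m`. -/
theorem exists_permutation_model {K L : Type*} [Field K] [Field L] [Algebra K L] (F : K[X])
    [IsSplittingField K L F] {m : ℕ} (hm : (F.rootSet L).ncard = m)
    [MulAction.IsPretransitive Gal(L/K) (F.rootSet L)] [DecidableEq L] {g : Gal(L/K)}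
    (hg : (MulAction.toPermHom Gal(L/K) (F.rootSet L) g).IsSwap) :
    ∃ (H : Subgroup (Equiv.Perm (Fin m))) (φ : Gal(L/K) ≃* H) (e : Fin m ≃ F.rootSet L),
      (∀ g i, (e ((φ g : Equiv.Perm (Fin m)) i) : L) = g (e i)) ∧
      MulAction.IsPretransitive H (Fin m) ∧ ∃ τ ∈ H, τ.IsSwap := by
  let e : F.rootSet L ≃ Fin m := Finite.equivFinOfCardEq hm
  let f : Gal(L/K) →* Equiv.Perm (Fin m) :=
    e.permCongrHom.toMonoidHom.comp (MulAction.toPermHom Gal(L/K) (F.rootSet L))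
  have hf : Function.Injective f := e.permCongrHom.injective.comp
    ((injective_iff_map_eq_one _).2 fun g hg => faithful_rootSet hg)
  have hfe : ∀ g i, e.symm (f g i) = g • e.symm i := fun g i => e.symm_apply_apply _
  refine ⟨f.range, MonoidHom.ofInjective hf, e.symm, fun g i => congrArg Subtype.val (hfe g i),
    ⟨fun a b => ?_⟩, f g, ⟨g, rfl⟩, hg.permCongr e⟩
  obtain ⟨g, hg⟩ := MulAction.exists_smul_eq Gal(L/K) (e.symm a) (e.symm b)
  refine ⟨⟨f g, g, rfl⟩, e.symm.injective ?_⟩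
  exact (hfe g a).trans hg

/-! ### Lifting automorphisms through a specialization. -/

/-- An integral extension can be mapped to any algebraically closed extension of the base. -/
theorem exists_ringHom_of_isIntegral {A B Ω : Type*} [CommRing A] [CommRing B] [IsDomain B]
    [Algebra A B] [FaithfulSMul A B] [Algebra.IsIntegral A B] [Field Ω] [IsAlgClosed Ω]
    (φ : A →+* Ω) : ∃ ψ : B →+* Ω, ψ.comp (algebraMap A B) = φ := by
  have hφ : (RingHom.ker φ).IsPrime := RingHom.ker_isPrime φ
  obtain ⟨Q, hQ, hQp⟩ := Ideal.exists_ideal_over_prime_of_isIntegral_of_isDomain (S := B)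
    (RingHom.ker φ) (by
      rw [(RingHom.injective_iff_ker_eq_bot _).1 (FaithfulSMul.algebraMap_injective A B)]
      exact bot_le)
  let P := RingHom.ker φ
  have : Q.LiesOver P := ⟨hQp.symm⟩
  let : Algebra (A ⧸ P) Ω := (RingHom.kerLift φ).toAlgebra
  have : FaithfulSMul (A ⧸ P) Ω :=
    (faithfulSMul_iff_algebraMap_injective _ _).2 (RingHom.kerLift_injective φ)
  have hP : P.IsPrime := hφ
  have : IsDomain (A ⧸ P) := Ideal.Quotient.isDomain P
  have : IsDomain (B ⧸ Q) := Ideal.Quotient.isDomain Q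
  have : FaithfulSMul (A ⧸ P) (B ⧸ Q) := inferInstance
  have : Module.IsTorsionFree (A ⧸ P) (B ⧸ Q) := FaithfulSMul.to_isTorsionFree _ _
  have : Module.IsTorsionFree (A ⧸ P) Ω := FaithfulSMul.to_isTorsionFree _ _
  let ψ : (B ⧸ Q) →ₐ[A ⧸ P] Ω := IsAlgClosed.lift
  refine ⟨ψ.toRingHom.comp (Ideal.Quotient.mk Q), RingHom.ext fun a => ?_⟩
  exact ψ.commutes (Ideal.Quotient.mk P a)

/-- Automorphisms of the residue field lift to the Galois group. -/
theorem exists_smul_eq_of_ringEquiv {A B G Ω : Type*} [CommRing A] [CommRing B] [Algebra A B]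
    [Group G] [Finite G] [MulSemiringAction G B] [Algebra.IsInvariant A B G] [SMulCommClass G A B]
    [Field Ω] (ψ : B →+* Ω) (σ : Ω ≃+* Ω)
    (hσ : ∀ a : A, σ (ψ (algebraMap A B a)) = ψ (algebraMap A B a)) :
    ∃ g : G, ∀ b, ψ (g • b) = σ (ψ b) := by
  let Q := RingHom.ker ψ
  have : Q.IsPrime := RingHom.ker_isPrime ψ
  let P := Q.under A
  have : Q.LiesOver P := ⟨rfl⟩
  let : Algebra (B ⧸ Q) Ω := (RingHom.kerLift ψ).toAlgebra
  have hinj : Function.Injective (algebraMap (B ⧸ Q) Ω) := RingHom.kerLift_injective ψ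
  have : FaithfulSMul (B ⧸ Q) Ω := (faithfulSMul_iff_algebraMap_injective _ _).2 hinj
  let : Algebra (A ⧸ P) Ω := ((algebraMap (B ⧸ Q) Ω).comp (algebraMap (A ⧸ P) (B ⧸ Q))).toAlgebra
  have : IsScalarTower (A ⧸ P) (B ⧸ Q) Ω := IsScalarTower.of_algebraMap_eq fun _ => rfl
  let σ' : Ω ≃ₐ[A ⧸ P] Ω := AlgEquiv.ofRingEquiv (f := σ) (by
    intro x
    obtain ⟨a, rfl⟩ := Ideal.Quotient.mk_surjective x
    exact hσ a)
  -- The residue extension is normal, so `σ'` induces an automorphism of `B ⧸ Q`; the decomposition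
  -- group of `Q` maps onto these automorphisms.
  obtain ⟨τ, hτ⟩ := Ideal.Quotient.exists_algEquiv_fixedPoint_quotient_under G P Q σ'
  obtain ⟨g, rfl⟩ := Ideal.Quotient.stabilizerHom_surjective G P Q τ
  exact ⟨g, fun b => hτ (Ideal.Quotient.mk Q b)⟩

/-! ### Comparison of a splitting field with a larger extension. -/

section Transfer

variable {M L Ω : Type*} [Field M] [Field L] [Field Ω] [Algebra M L] [Algebra L Ω] [Algebra M Ω]
  [IsScalarTower M L Ω] (F : M[X]) [IsSplittingField M L F]

variable (L Ω) in
/-- The roots of a polynomial in a splitting field are its roots in any extension of that field. -/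
def rootSetEquivOfIsSplittingField : F.rootSet L ≃ F.rootSet Ω :=
  (Equiv.Set.image (algebraMap L Ω) (F.rootSet L) (algebraMap L Ω).injective).trans
    (Equiv.setCongr ((IsSplittingField.splits L F).image_rootSet (IsScalarTower.toAlgHom M L Ω)))

theorem toPermHom_eq_permCongr_restrictNormal [Normal M L] (g : Gal(Ω/M)) :
    MulAction.toPermHom Gal(Ω/M) (F.rootSet Ω) g = (rootSetEquivOfIsSplittingField L Ω F).permCongr
      (MulAction.toPermHom Gal(L/M) (F.rootSet L) (g.restrictNormal L)) := by
  refine Equiv.ext fun y => ?_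
  obtain ⟨x, rfl⟩ := (rootSetEquivOfIsSplittingField L Ω F).surjective y
  rw [Equiv.permCongr_apply, Equiv.symm_apply_apply]
  exact Subtype.ext (g.restrictNormal_commutes L (x : L)).symm

theorem surjective_toPermHom_of_splittingField [Normal M Ω]
    (h : Function.Surjective (MulAction.toPermHom Gal(L/M) (F.rootSet L))) :
    Function.Surjective (MulAction.toPermHom Gal(Ω/M) (F.rootSet Ω)) := by
  have : Normal M L := Normal.of_isSplittingField F
  intro ρ
  obtain ⟨g, hg⟩ := h ((rootSetEquivOfIsSplittingField L Ω F).symm.permCongr ρ)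
  obtain ⟨g', rfl⟩ := AlgEquiv.restrictNormalHom_surjective Ω g
  refine ⟨g', (toPermHom_eq_permCongr_restrictNormal (L := L) F g').trans ?_⟩
  refine (congrArg (rootSetEquivOfIsSplittingField L Ω F).permCongr hg).trans ?_
  ext x
  simp [Equiv.permCongr_apply]

theorem surjective_toPermHom_splittingField
    (h : Function.Surjective (MulAction.toPermHom Gal(Ω/M) (F.rootSet Ω))) :
    Function.Surjective (MulAction.toPermHom Gal(L/M) (F.rootSet L)) := by
  have : Normal M L := Normal.of_isSplittingField F
  intro ρ
  obtain ⟨g, hg⟩ := h ((rootSetEquivOfIsSplittingField L Ω F).permCongr ρ)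
  rw [toPermHom_eq_permCongr_restrictNormal (L := L)] at hg
  exact ⟨_, Equiv.injective _ hg⟩

theorem exists_isSwap_of_splittingField [Normal M Ω] [DecidableEq L] [DecidableEq Ω]
    (h : ∃ g : Gal(L/M), (MulAction.toPermHom Gal(L/M) (F.rootSet L) g).IsSwap) :
    ∃ g : Gal(Ω/M), (MulAction.toPermHom Gal(Ω/M) (F.rootSet Ω) g).IsSwap := by
  have : Normal M L := Normal.of_isSplittingField F
  obtain ⟨g, hg⟩ := h
  obtain ⟨g', rfl⟩ := AlgEquiv.restrictNormalHom_surjective Ω g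
  refine ⟨g', ?_⟩
  rw [toPermHom_eq_permCongr_restrictNormal (L := L)]
  exact hg.permCongr _

end Transfer

/-! ### Even degree over `ℚ(y)`. -/

theorem surjective_toPermHom_bonacci_algebraicClosure {m : ℕ} (hm : 2 ≤ m) (he : Even m) :
    Function.Surjective (MulAction.toPermHom Gal((AlgebraicClosure ℚ)/ℚ)
      (((bonacci m).map (algebraMap ℤ ℚ)).rootSet (AlgebraicClosure ℚ))) := by
  obtain ⟨L, _, _, _⟩ := exists_numberField_isSplittingField ((bonacci m).map (algebraMap ℤ ℚ))
  have : IsGalois ℚ L :=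
    IsGalois.of_separable_splitting_field (bonacci_irreducible_rat hm).separable
  let ι : L →ₐ[ℚ] AlgebraicClosure ℚ := IsAlgClosed.lift
  let : Algebra L (AlgebraicClosure ℚ) := ι.toRingHom.toAlgebra
  have : IsScalarTower ℚ L (AlgebraicClosure ℚ) :=
    IsScalarTower.of_algebraMap_eq fun x => (ι.commutes x).symm
  have : IsAlgClosure ℚ (AlgebraicClosure ℚ) := by
    refine ⟨inferInstance, ?_⟩
    convert AlgebraicClosure.isAlgebraic ℚ
    · rfl
    · exact Subsingleton.elim _ _
  have : Normal ℚ (AlgebraicClosure ℚ) := IsAlgClosure.normal ℚ _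
  exact surjective_toPermHom_of_splittingField (L := L) _ (bonacci_surjective_of_even hm he)

/-- The map `y ↦ -1` extends to `ψ : B → ℚ̄`. It carries the roots bijectively to those of `bonacci
m`, which are distinct, and every permutation of the latter is Galois over `ℚ` and lifts along `ψ`.
-/
theorem surjective_toPermHom_overRatFunc_rat_of_even {L : Type*} [Field L]
    [Algebra (RatFunc ℚ) L] {m j : ℕ} (hm : 2 ≤ m) (he : Even m) (hj : Odd j)
    [IsSplittingField (RatFunc ℚ) L (overRatFunc ℚ (thickCyclePoly m j))] :
    Function.Surjective (MulAction.toPermHom Gal(L/RatFunc ℚ)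
      ((overRatFunc ℚ (thickCyclePoly m j)).rootSet L)) := by
  classical
  have hm1 : 1 ≤ m := by omega
  have hf := thickCyclePolyOver_monic ℚ j hm1
  have hfL := map_thickCyclePolyOver ℚ m j
  have : IsGalois (RatFunc ℚ) L := isGalois_of_isSplittingField_overRatFunc (K := ℚ) L hm1 hj.pos
  have : FiniteDimensional (RatFunc ℚ) L :=
    IsSplittingField.finiteDimensional L (overRatFunc ℚ (thickCyclePoly m j))
  have hsplit : IsSplittingField (RatFunc ℚ) L
      ((thickCyclePolyOver ℚ m j).map (algebraMap ℚ[X] (RatFunc ℚ))) := by rwa [hfL]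
  let : Algebra ℚ[X] L := ((algebraMap (RatFunc ℚ) L).comp (algebraMap ℚ[X] (RatFunc ℚ))).toAlgebra
  have : IsScalarTower ℚ[X] (RatFunc ℚ) L := IsScalarTower.of_algebraMap_eq fun _ => rfl
  let B := integralClosure ℚ[X] L
  let := IsIntegralClosure.MulSemiringAction ℚ[X] (RatFunc ℚ) L B
  have : SMulDistribClass Gal(L/RatFunc ℚ) B L := inferInstance
  have := IsIntegralClosure.isFractionRing_of_finite_extension ℚ[X] (RatFunc ℚ) L B
  have hG := IsGaloisGroup.of_isFractionRing Gal(L/RatFunc ℚ) ℚ[X] B (RatFunc ℚ) L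
  have := hG.commutes
  have := hG.isInvariant
  have hinj : FaithfulSMul ℚ[X] B := by
    rw [faithfulSMul_iff_algebraMap_injective]
    have h : Function.Injective (algebraMap ℚ[X] L) :=
      (algebraMap (RatFunc ℚ) L).injective.comp (IsFractionRing.injective ℚ[X] (RatFunc ℚ))
    rw [IsScalarTower.algebraMap_eq ℚ[X] B L, RingHom.coe_comp] at h
    exact Function.Injective.of_comp h
  have hB := splits_integralClosure (RatFunc ℚ) L B hf (IsSplittingField.splits L _)
  let Ω := AlgebraicClosure ℚ
  obtain ⟨ψ, hψ⟩ := exists_ringHom_of_isIntegral (B := B)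
    ((algebraMap ℚ Ω).comp (evalRingHom (-1)))
  have hmap : ((thickCyclePolyOver ℚ m j).map (algebraMap ℚ[X] B)).map ψ =
      ((bonacci m).map (algebraMap ℤ ℚ)).map (algebraMap ℚ Ω) := by
    rw [Polynomial.map_map, hψ, thickCyclePolyOver, Polynomial.map_map,
      ← map_eval_neg_one_thickCyclePoly m hj, Polynomial.map_map, Polynomial.map_map]
    congr 1
    exact Polynomial.ringHom_ext' (RingHom.ext_int _ _) (by simp)
  let S := ((bonacci m).map (algebraMap ℤ ℚ)).rootSet Ω
  have hirr := bonacci_irreducible_rat hm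
  have hmem : ∀ b : B, b ∈ (thickCyclePolyOver ℚ m j).rootSet B → ψ b ∈ S := by
    intro b hb
    rw [mem_rootSet_iff_of_monic hf] at hb
    rw [mem_rootSet_iff_of_monic ((bonacci_monic hm1).map _), ← eval_map_algebraMap, ← hmap,
      eval_map_apply, eval_map_algebraMap, hb, map_zero]
  let e₀ : (thickCyclePolyOver ℚ m j).rootSet B → S := fun b => ⟨ψ b, hmem b b.2⟩
  have hsurj : Function.Surjective e₀ := by
    rintro ⟨s, hs⟩
    rw [mem_rootSet_iff_of_monic ((bonacci_monic hm1).map _), ← eval_map_algebraMap, ← hmap,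
      hB.eq_prod_roots_of_monic (hf.map _), Polynomial.map_multiset_prod, eval_multiset_prod,
      Multiset.prod_eq_zero_iff, Multiset.map_map, Multiset.map_map, Multiset.mem_map] at hs
    obtain ⟨r, hr, hrs⟩ := hs
    have hrs' : s = ψ r := by simpa [sub_eq_zero] using hrs
    refine ⟨⟨r, ?_⟩, Subtype.ext hrs'.symm⟩
    rw [mem_rootSet_iff_of_monic hf, ← eval_map_algebraMap]
    exact (mem_roots'.1 hr).2
  have hS : Nat.card S = m := by
    rw [Nat.card_coe_set_eq, ncard_rootSet_of_separable hirr.separable (IsAlgClosed.splits _),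
      (bonacci_monic hm1).natDegree_map, bonacci_natDegree hm1]
  have hX : Nat.card ((thickCyclePolyOver ℚ m j).rootSet B) ≤ m := by
    rw [Nat.card_coe_set_eq]
    refine (ncard_rootSet_le_natDegree _).trans ?_
    rw [thickCyclePolyOver, (thickCyclePoly_monic j hm1).natDegree_map,
      thickCyclePoly_natDegree j hm1]
  have hbij : Function.Bijective e₀ := by
    refine (Nat.bijective_iff_surjective_and_card e₀).2 ⟨hsurj, le_antisymm (hX.trans hS.ge) ?_⟩
    exact Nat.card_le_card_of_surjective e₀ hsurj
  let e := Equiv.ofBijective e₀ hbij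
  refine hfL ▸ surjective_toPermHom_of_equiv (rootSetEquiv (RatFunc ℚ) L B hf)
    (rootSetEquiv_smul (RatFunc ℚ) L B (G := Gal(L/RatFunc ℚ)) hf) fun ρ => ?_
  obtain ⟨σ, hσ⟩ := surjective_toPermHom_bonacci_algebraicClosure hm he (e.permCongr ρ)
  obtain ⟨g, hg⟩ := exists_smul_eq_of_ringEquiv (A := ℚ[X]) (G := Gal(L/RatFunc ℚ)) ψ
    σ.toRingEquiv fun a => by
      have h1 : ψ (algebraMap ℚ[X] B a) = algebraMap ℚ Ω (a.eval (-1)) := RingHom.congr_fun hψ a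
      rw [h1]
      exact σ.commutes _
  refine ⟨g, Equiv.ext fun x => e.injective (Subtype.ext ?_)⟩
  refine (hg x).trans ?_
  have := congrArg Subtype.val (Equiv.congr_fun hσ (e x))
  rw [Equiv.permCongr_apply, Equiv.symm_apply_apply] at this
  exact this

/-! ### Descent from `ℚ(y)` to `ℚ̄(y)` and `k(y)` in even degree. -/

/-- By `hnorm`, conjugation by `Gal(Ω/E₀)` preserves `Gal(Ω/E₁)`. Since the former induces all
permutations, the image of the latter contains every conjugate of one transposition, and these
generate. -/
theorem surjective_toPermHom_of_conj {E₀ E₁ Ω : Type*} [Field E₀] [Field E₁] [Field Ω]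
    [Algebra E₀ E₁] [Algebra E₁ Ω] [Algebra E₀ Ω] [IsScalarTower E₀ E₁ Ω] [DecidableEq Ω] {F : E₀[X]}
    (hnorm : ∀ (σ : Gal(Ω/E₀)) (z : E₁), ∃ z', σ (algebraMap E₁ Ω z) = algebraMap E₁ Ω z')
    (h₀ : Function.Surjective (MulAction.toPermHom Gal(Ω/E₀) (F.rootSet Ω)))
    {τ : Gal(Ω/E₁)} (h₁ : (MulAction.toPermHom Gal(Ω/E₁)
      ((F.map (algebraMap E₀ E₁)).rootSet Ω) τ).IsSwap) :
    Function.Surjective (MulAction.toPermHom Gal(Ω/E₁)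
      ((F.map (algebraMap E₀ E₁)).rootSet Ω)) := by
  set R := (F.map (algebraMap E₀ E₁)).rootSet Ω with hR
  have hset : F.rootSet Ω = R := by
    rw [hR, rootSet_def, rootSet_def, aroots_def, aroots_def, Polynomial.map_map,
      ← IsScalarTower.algebraMap_eq]
  let e : F.rootSet Ω ≃ R := Equiv.setCongr hset
  rw [← MonoidHom.range_eq_top, eq_top_iff, ← Equiv.Perm.closure_isSwap, Subgroup.closure_le]
  rintro _ ⟨a, b, hab, rfl⟩
  obtain ⟨x, y, hxy, hτ⟩ := h₁
  obtain ⟨c, hc⟩ := isConj_iff.1 (Equiv.Perm.isConj_swap hxy hab)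
  obtain ⟨σ, hσ⟩ := h₀ (e.symm.permCongr c)
  have hσc : ∀ x : R, σ x = c x := fun x => congrArg Subtype.val (Equiv.congr_fun hσ (e.symm x))
  have hσc' : ∀ x : R, σ.symm x = (c⁻¹ x : R) := fun x => by
    rw [AlgEquiv.symm_apply_eq, hσc]
    exact congrArg Subtype.val (c.apply_symm_apply x).symm
  let τ' : Gal(Ω/E₁) := AlgEquiv.ofRingEquiv
    (f := (σ.symm.toRingEquiv.trans τ.toRingEquiv).trans σ.toRingEquiv) fun z => by
      obtain ⟨z', hz'⟩ := hnorm σ.symm z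
      change σ (τ (σ.symm (algebraMap E₁ Ω z))) = _
      rw [hz', τ.commutes, ← hz', AlgEquiv.apply_symm_apply]
  refine ⟨τ', ?_⟩
  rw [← hc, ← hτ]
  refine Equiv.ext fun x => Subtype.ext ?_
  change σ (τ (σ.symm x)) = _
  rw [hσc', Equiv.Perm.mul_apply, Equiv.Perm.mul_apply, ← hσc]
  rfl

/-- An automorphism fixing the variable preserves the rational functions over the algebraic numbers. -/
theorem exists_algebraMap_ratFunc_eq {K Ω : Type*} [Field K] [CharZero K] [IsAlgClosed K]
    [Algebra.IsAlgebraic ℚ K] [Field Ω] [Algebra (RatFunc K) Ω] (σ : Ω →+* Ω)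
    (hX : σ (algebraMap (RatFunc K) Ω RatFunc.X) = algebraMap (RatFunc K) Ω RatFunc.X)
    (z : RatFunc K) : ∃ z', σ (algebraMap (RatFunc K) Ω z) = algebraMap (RatFunc K) Ω z' := by
  let S := (algebraMap (RatFunc K) Ω).fieldRange
  suffices h : σ (algebraMap (RatFunc K) Ω z) ∈ S by
    obtain ⟨z', hz'⟩ := h
    exact ⟨z', hz'.symm⟩
  let ι : K →+* Ω := (algebraMap (RatFunc K) Ω).comp RatFunc.C
  have hC : ∀ c : K, σ (ι c) ∈ S := by
    intro c
    -- An automorphism sends `c` to another root of its minimal polynomial over `ℚ`, and all these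
    -- roots lie in `K`.
    have hs : ((minpoly ℚ c).map (algebraMap ℚ K)).Splits := IsAlgClosed.splits _
    have h0 : eval (σ (ι c)) (((minpoly ℚ c).map (algebraMap ℚ K)).map ι) = 0 := by
      have h1 : eval c ((minpoly ℚ c).map (algebraMap ℚ K)) = 0 := by
        rw [eval_map_algebraMap, minpoly.aeval]
      have h2 : ((minpoly ℚ c).map (algebraMap ℚ K)).map ι =
          ((minpoly ℚ c).map (algebraMap ℚ K)).map (σ.comp ι) := by
        rw [Polynomial.map_map, Polynomial.map_map]
        congr 1
        exact RingHom.ext_rat _ _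
      rw [h2, ← RingHom.comp_apply, eval_map_apply, h1, map_zero]
    have hmon : ((minpoly ℚ c).map (algebraMap ℚ K)).Monic :=
      (minpoly.monic (Algebra.IsIntegral.isIntegral c)).map _
    rw [hs.eq_prod_roots_of_monic hmon, Polynomial.map_multiset_prod, eval_multiset_prod,
      Multiset.prod_eq_zero_iff, Multiset.map_map, Multiset.map_map, Multiset.mem_map] at h0
    obtain ⟨r, -, hr⟩ := h0
    have hr' : σ (ι c) = ι r := by simpa [sub_eq_zero] using hr
    exact ⟨RatFunc.C r, hr'.symm⟩
  have hp : ∀ p : K[X], σ (algebraMap (RatFunc K) Ω (algebraMap K[X] (RatFunc K) p)) ∈ S := by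
    intro p
    induction p using Polynomial.induction_on' with
    | add p q hp hq =>
      rw [map_add, map_add, map_add]
      exact add_mem hp hq
    | monomial n a =>
      rw [← C_mul_X_pow_eq_monomial, map_mul, map_pow, RatFunc.algebraMap_C, RatFunc.algebraMap_X,
        map_mul, map_mul, map_pow, map_pow, hX]
      exact mul_mem (hC a) (pow_mem (RingHom.mem_fieldRange.2 ⟨RatFunc.X, rfl⟩) n)
  rw [← RatFunc.num_div_denom z, map_div₀, map_div₀]
  exact div_mem (hp _) (hp _)

/-- The inclusion `k(y) → K(y)`. -/
def ratFuncMap (k K : Type*) [Field k] [Field K] [Algebra k K] : RatFunc k →+* RatFunc K :=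
  IsFractionRing.map (j := mapRingHom (algebraMap k K))
    (map_injective _ (algebraMap k K).injective)

theorem ratFuncMap_algebraMap (k K : Type*) [Field k] [Field K] [Algebra k K] (p : k[X]) :
    ratFuncMap k K (algebraMap k[X] (RatFunc k) p) =
      algebraMap K[X] (RatFunc K) (p.map (algebraMap k K)) :=
  IsLocalization.map_eq (M := nonZeroDivisors k[X]) (T := nonZeroDivisors K[X])
    (nonZeroDivisors_le_comap_nonZeroDivisors_of_injective _
      (map_injective _ (algebraMap k K).injective)) p

theorem ratFuncMap_X (k K : Type*) [Field k] [Field K] [Algebra k K] :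
    ratFuncMap k K RatFunc.X = RatFunc.X := by
  rw [← RatFunc.algebraMap_X, ratFuncMap_algebraMap, map_X, RatFunc.algebraMap_X]

theorem map_ratFuncMap_overRatFunc (k K : Type*) [Field k] [Field K] [Algebra k K] (T : ℤ[X][X]) :
    (overRatFunc k T).map (ratFuncMap k K) = overRatFunc K T := by
  rw [overRatFunc, overRatFunc, Polynomial.map_map]
  congr 1
  refine Polynomial.ringHom_ext' (RingHom.ext_int _ _) ?_
  simp [ratFuncMap_X]

theorem isAlgebraic_fractionField {A B K L : Type*} [CommRing A] [IsDomain A] [CommRing B]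
    [Field K] [Field L] [Algebra A B] [Algebra.IsAlgebraic A B] [Algebra A K] [IsFractionRing A K]
    [Algebra B L] [IsFractionRing B L] [Algebra K L]
    (h : ∀ a, algebraMap K L (algebraMap A K a) = algebraMap B L (algebraMap A B a)) :
    Algebra.IsAlgebraic K L := by
  let : Algebra A L := ((algebraMap B L).comp (algebraMap A B)).toAlgebra
  have h1 : IsScalarTower A K L := IsScalarTower.of_algebraMap_eq fun p => (h p).symm
  have h2 : IsScalarTower A B L := IsScalarTower.of_algebraMap_eq fun p => rfl
  have h4 : FaithfulSMul A L := by
    rw [faithfulSMul_iff_algebraMap_injective, IsScalarTower.algebraMap_eq A K L]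
    exact (algebraMap K L).injective.comp (IsFractionRing.injective A K)
  have h5 : Module.IsTorsionFree A L := FaithfulSMul.to_isTorsionFree _ _
  have h3 : Algebra.IsAlgebraic A L := (IsFractionRing.isAlgebraic_iff' A B L).1 inferInstance
  exact IsFractionRing.comap_isAlgebraic_iff.1 h3

theorem isAlgebraic_ratFuncMap (k K : Type*) [Field k] [Field K] [Algebra k K]
    [Algebra.IsAlgebraic k K] :
    letI := (ratFuncMap k K).toAlgebra
    Algebra.IsAlgebraic (RatFunc k) (RatFunc K) := by
  let := (ratFuncMap k K).toAlgebra
  let := Polynomial.algebra k K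
  exact isAlgebraic_fractionField (A := k[X]) (B := K[X]) (ratFuncMap_algebraMap k K)

theorem exists_isAlgClosed_isAlgebraic.{u} (E : Type u) [Field E] :
    ∃ (Ω : Type u) (_ : Field Ω) (_ : Algebra E Ω), IsAlgClosed Ω ∧ Algebra.IsAlgebraic E Ω :=
  ⟨AlgebraicClosure E, inferInstance, inferInstance, inferInstance, inferInstance⟩

theorem normal_of_isAlgClosed (E Ω : Type*) [Field E] [Field Ω] [Algebra E Ω] [IsAlgClosed Ω]
    [Algebra.IsAlgebraic E Ω] : Normal E Ω :=
  have : IsAlgClosure E Ω := ⟨inferInstance, inferInstance⟩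
  IsAlgClosure.normal E Ω

/-- In the tower `ℚ(y) ⊆ k(y) ⊆ K(y) ⊆ Ω` with `K` an algebraic closure of `k`, the full group over
`ℚ(y)` and the transposition over `K(y)` make the group over `K(y)` full. Its elements also fix
`k(y)`, so the group there is full as well. -/
theorem surjective_toPermHom_overRatFunc_of_even {k L : Type*} [Field k] [NumberField k] [Field L]
    [Algebra (RatFunc k) L] {m j : ℕ} (hm : 2 ≤ m) (he : Even m) (hj : Odd j)
    [IsSplittingField (RatFunc k) L (overRatFunc k (thickCyclePoly m j))] :
    Function.Surjective (MulAction.toPermHom Gal(L/RatFunc k)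
      ((overRatFunc k (thickCyclePoly m j)).rootSet L)) := by
  classical
  let K := AlgebraicClosure k
  have : CharZero K := charZero_of_injective_algebraMap (algebraMap k K).injective
  have : Algebra.IsAlgebraic ℚ K := Algebra.IsAlgebraic.trans ℚ k K
  let T := thickCyclePoly m j
  obtain ⟨Ω, _, _, _, _⟩ := exists_isAlgClosed_isAlgebraic (RatFunc K)
  have : Normal (RatFunc K) Ω := normal_of_isAlgClosed _ _
  let : Algebra (RatFunc ℚ) (RatFunc k) := (ratFuncMap ℚ k).toAlgebra
  let : Algebra (RatFunc k) (RatFunc K) := (ratFuncMap k K).toAlgebra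
  let : Algebra (RatFunc ℚ) (RatFunc K) := (ratFuncMap ℚ K).toAlgebra
  have halg : Algebra.IsAlgebraic (RatFunc ℚ) (RatFunc K) := isAlgebraic_ratFuncMap ℚ K
  let : Algebra (RatFunc ℚ) Ω := ((algebraMap (RatFunc K) Ω).comp (ratFuncMap ℚ K)).toAlgebra
  let : Algebra (RatFunc k) Ω := ((algebraMap (RatFunc K) Ω).comp (ratFuncMap k K)).toAlgebra
  have : IsScalarTower (RatFunc ℚ) (RatFunc K) Ω := IsScalarTower.of_algebraMap_eq fun _ => rfl
  have : IsScalarTower (RatFunc k) (RatFunc K) Ω := IsScalarTower.of_algebraMap_eq fun _ => rfl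
  have : Algebra.IsAlgebraic (RatFunc ℚ) Ω := Algebra.IsAlgebraic.trans (RatFunc ℚ) (RatFunc K) Ω
  have : Normal (RatFunc ℚ) Ω := normal_of_isAlgClosed _ _
  have hℚ : Function.Surjective (MulAction.toPermHom Gal(Ω/RatFunc ℚ)
      ((overRatFunc ℚ T).rootSet Ω)) := by
    let L' := (overRatFunc ℚ T).SplittingField
    let ι : L' →ₐ[RatFunc ℚ] Ω := IsSplittingField.lift L' (overRatFunc ℚ T) (IsAlgClosed.splits _)
    let : Algebra L' Ω := ι.toRingHom.toAlgebra
    have : IsScalarTower (RatFunc ℚ) L' Ω :=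
      IsScalarTower.of_algebraMap_eq fun x => (ι.commutes x).symm
    exact surjective_toPermHom_of_splittingField (L := L') _
      (surjective_toPermHom_overRatFunc_rat_of_even hm he hj)
  have hK : ∃ τ : Gal(Ω/RatFunc K), (MulAction.toPermHom Gal(Ω/RatFunc K)
      ((overRatFunc K T).rootSet Ω) τ).IsSwap := by
    let L' := (overRatFunc K T).SplittingField
    let ι : L' →ₐ[RatFunc K] Ω := IsSplittingField.lift L' (overRatFunc K T) (IsAlgClosed.splits _)
    let : Algebra L' Ω := ι.toRingHom.toAlgebra
    have : IsScalarTower (RatFunc K) L' Ω :=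
      IsScalarTower.of_algebraMap_eq fun x => (ι.commutes x).symm
    have : IsGalois (RatFunc K) L' :=
      isGalois_of_isSplittingField_overRatFunc (K := K) (m := m) L' (by omega) hj.pos
    exact exists_isSwap_of_splittingField (L := L') _ (exists_isSwap_overRatFunc hm hj)
  have hKsurj : Function.Surjective (MulAction.toPermHom Gal(Ω/RatFunc K)
      ((overRatFunc K T).rootSet Ω)) := by
    obtain ⟨τ, hτ⟩ := hK
    have hF : (overRatFunc ℚ T).map (algebraMap (RatFunc ℚ) (RatFunc K)) = overRatFunc K T :=
      map_ratFuncMap_overRatFunc ℚ K T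
    rw [← hF] at hτ ⊢
    refine surjective_toPermHom_of_conj (fun σ z => ?_) hℚ hτ
    refine exists_algebraMap_ratFunc_eq (σ : Ω →+* Ω) ?_ z
    have h1 := σ.commutes RatFunc.X
    have h2 : algebraMap (RatFunc ℚ) Ω RatFunc.X = algebraMap (RatFunc K) Ω RatFunc.X :=
      congrArg _ (ratFuncMap_X ℚ K)
    rw [h2] at h1
    exact h1
  let ι : L →ₐ[RatFunc k] Ω := IsSplittingField.lift L (overRatFunc k T) (IsAlgClosed.splits _)
  let : Algebra L Ω := ι.toRingHom.toAlgebra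
  have : IsScalarTower (RatFunc k) L Ω :=
    IsScalarTower.of_algebraMap_eq fun x => (ι.commutes x).symm
  refine surjective_toPermHom_splittingField (Ω := Ω) _ ?_
  have hset : (overRatFunc k T).rootSet Ω = (overRatFunc K T).rootSet Ω := by
    rw [← map_ratFuncMap_overRatFunc k K T, rootSet_def, rootSet_def, aroots_def, aroots_def,
      Polynomial.map_map]
    rfl
  intro ρ
  let e := Equiv.setCongr hset
  obtain ⟨g, hg⟩ := hKsurj (e.permCongr ρ)
  refine ⟨g.restrictScalars (RatFunc k), Equiv.ext fun x => Subtype.ext ?_⟩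
  have h := congrArg Subtype.val (Equiv.congr_fun hg (e x))
  rw [Equiv.permCongr_apply, Equiv.symm_apply_apply] at h
  exact h

end

theorem mainTheorem7 (k : Type*) [Field k] [NumberField k] (n j : ℕ) (hn : 3 ≤ n) (hj : Odd j) :
    -- the Galois group over `k(y)`, as a permutation group of the `n - 1` roots of `T(C_n^j; x, y)`,
    -- is a transitive group that contains a transposition
    (∃ (H : Subgroup (Equiv.Perm (Fin (n - 1))))
        (φ : (overRatFunc k (thickCycle n j).tuttePoly).Gal ≃* H)
        (e : Fin (n - 1) ≃ (overRatFunc k (thickCycle n j).tuttePoly).rootSet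
          (overRatFunc k (thickCycle n j).tuttePoly).SplittingField),
      (∀ g i, (e ((φ g : Equiv.Perm (Fin (n - 1))) i) :
          (overRatFunc k (thickCycle n j).tuttePoly).SplittingField) = g (e i)) ∧
      MulAction.IsPretransitive H (Fin (n - 1)) ∧
      ∃ τ ∈ H, τ.IsSwap) ∧
    (Odd n → Nonempty ((overRatFunc k (thickCycle n j).tuttePoly).Gal ≃*
      Equiv.Perm (Fin (n - 1)))) ∧
    (Nat.Prime (n - 1) →
      Nonempty ((overRatFunc k (thickCycle n j).tuttePoly).Gal ≃* Equiv.Perm (Fin (n - 1))) ∧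
      Nonempty ((specializeY (-1) (thickCycle n j).tuttePoly).Gal ≃*
        Equiv.Perm (Fin (n - 1)))) := by
  classical
  rw [tuttePoly_thickCycle n j (by omega), specializeY_thickCyclePoly (n - 1) hj]
  have hm : 2 ≤ n - 1 := by omega
  have hm1 : 1 ≤ n - 1 := by omega
  set F := overRatFunc k (thickCyclePoly (n - 1) j) with hF
  have hcard : (F.rootSet F.SplittingField).ncard = n - 1 :=
    ncard_rootSet_overRatFunc_thickCyclePoly F.SplittingField hm1 hj.pos
  refine ⟨?_, fun hodd => ?_, fun hp => ⟨?_, nonempty_gal_bonacci_mulEquiv_perm hp⟩⟩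
  · have : IsGalois (RatFunc k) F.SplittingField :=
      isGalois_of_isSplittingField_overRatFunc F.SplittingField hm1 hj.pos
    have : MulAction.IsPretransitive Gal(F.SplittingField/RatFunc k)
        (F.rootSet F.SplittingField) :=
      isPretransitive_rootSet (overRatFunc_thickCyclePoly_irreducible k hm1 hj.pos)
    obtain ⟨g, hg⟩ := exists_isSwap_overRatFunc (K := k) (L := F.SplittingField) hm hj
    exact exists_permutation_model F hcard hg
  · refine nonempty_gal_mulEquiv_perm (L := F.SplittingField) F hcard ?_
    exact surjective_toPermHom_overRatFunc_of_even hm (by grind) hj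
  · exact nonempty_gal_mulEquiv_perm (L := F.SplittingField) F hcard
      (surjective_toPermHom_overRatFunc_of_prime hp hj)
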